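/- Let $\beta>0$ and $L>0$. A stationary curve on $[0,L]$ is a curve $\mathbf{x}:[0,L]\to\mathbb{R}^3$, parametrized by arc length $s$, of class $C^1$ on $[0,L]$ and smooth on $(0,L)$ (no cusps there; the curvature may become infinite at the ends), with $\mathbf{x}(0)=\mathbf{0}$ and $\dot{\mathbf{x}}(0)=\mathbf{e}_z$, with integrable curvature $\kappa$, at which the energy $\int\sqrt{\kappa^2+\beta^2}\,\mathrm{d}s$ (the length of the curve being free) has vanishing first variation under all smooth perturbations of $\mathbf{x}$ that are compactly supported in $(0,L)$. A cuspless sub-Riemannian geodesic on $[0,L]$ is the lift $(\mathbf{x},R):[0,L]\to SE(3)$ of a stationary curve $\mathbf{x}$, with $R(0)=I$, $R$ continuous, $\dot{\mathbf{x}}=R\,\mathbf{e}_z$ on $[0,L]$ and, on $(0,L)$, $$\dot R=R\begin{pmatrix}0&0&\kappa_1\\0&0&\kappa_2\\-\kappa_1&-\kappa_2&0\end{pmatrix}.$$ Put $w_i=\kappa_i/\sqrt{\kappa_1^2+\kappa_2^2+\beta^2}$ for $i=1,2$. Let $(\mathbf{x},R)$ be a cuspless sub-Riemannian geodesic on $[0,L]$;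 for instance, $L$ may be the maximal length $s_{max}$ at which the curvature becomes infinite, if it is finite. Then $w_1\dot w_2-w_2\dot w_1$ equals a constant $W$ on $(0,L)$, and for every $s\in(0,L]$ the following are equivalent: 1. the vectors $\mathbf{e}_z$, $\mathbf{x}(s)$ and $\dot{\mathbf{x}}(s)$ are coplanar; 2. $\mathbf{e}_z\cdot(\mathbf{x}(s)\times\dot{\mathbf{x}}(s))=0$; 3. $\mathbf{x}$ is a planar curve, i.e. $\mathbf{x}([0,L])$ lies in a plane; 4. $W=0$. (At the end points $\dot{\mathbf{x}}$ denotes the one-sided derivative.) -/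

import Mathlib

open Set MeasureTheory
open scoped Matrix ContDiff

noncomputable section

/-- Euclidean three-space. -/
abbrev E3 : Type := EuclideanSpace ℝ (Fin 3)

/-- The unit vector along the third coordinate axis. -/
def eZ : E3 := !₂[0, 0, 1]

/-- The cross product of `E3`. -/
def cross (u v : E3) : E3 := WithLp.toLp 2 (u.ofLp ⨯₃ v.ofLp)

/-- The absolute curvature of a regular parametrized curve,
`‖y' × y''‖ / ‖y'‖ ^ 3`. -/
def absCurvature (y : ℝ → E3) (t : ℝ) : ℝ :=
  ‖cross (deriv y t) (deriv (deriv y) t)‖ / ‖deriv y t‖ ^ 3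

/-- The energy `∫ √(κ ^ 2 + β ^ 2) ds` of a regular curve with parameter interval `[0, L]`,
where `κ` is the absolute curvature and `ds = ‖y'(t)‖ dt` the element of spatial arc length.
The parameter `t` need not be the arc length, so the length of the curve is free. -/
def energy (β L : ℝ) (y : ℝ → E3) : ℝ :=
  ∫ t in (0 : ℝ)..L, Real.sqrt (absCurvature y t ^ 2 + β ^ 2) * ‖deriv y t‖

/-- `x : [0, L] → ℝ³` is a stationary curve of the problem of minimizing `∫ √(κ ^ 2 + β ^ 2) ds`
among the curves with prescribed end points and end directions, departing from the origin in the
direction `eZ`. The parameter is the spatial arc length; the curve is `C¹` on `[0, L]` and smooth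
on the open interval (no cusp there, although the curvature may tend to infinity at the ends);
its curvature is integrable, so the energy is finite; and the first variation of the energy
vanishes for all smooth perturbations that fix the curve near its ends. -/
structure IsStationaryCurve (β L : ℝ) (x : ℝ → E3) : Prop where
  contDiffOn_Icc : ContDiffOn ℝ 1 x (Icc 0 L)
  contDiffOn_Ioo : ContDiffOn ℝ ∞ x (Ioo 0 L)
  arcLength : ∀ s ∈ Icc 0 L, ‖derivWithin x (Icc 0 L) s‖ = 1
  start : x 0 = 0
  start_direction : derivWithin x (Icc 0 L) 0 = eZ
  integrable_curvature : IntegrableOn (absCurvature x) (Ioo 0 L)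
  stationary : ∀ v : ℝ → E3, ContDiff ℝ ∞ v → HasCompactSupport v → tsupport v ⊆ Ioo 0 L →
    HasDerivAt (fun ε : ℝ => energy β L (fun t => x t + ε • v t)) 0 0

/-- `s ↦ (x s, R s)`, `s ∈ [0, L]`, is a curve in `SE(3)`, starting at the unit element, which is
horizontal for the left-invariant distribution spanned by `A₃, A₄, A₅` and parametrized by the
spatial arc length: `x' = R eZ`, and the angular velocity is `-κ₂ A₄ + κ₁ A₅` (no twist about the
tangent), so that `x'' = R (κ₁, κ₂, 0)`. -/
structure IsHorizontalLift (L : ℝ) (x : ℝ → E3) (R : ℝ → Matrix (Fin 3) (Fin 3) ℝ)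
    (κ₁ κ₂ : ℝ → ℝ) : Prop where
  rotation : ∀ s ∈ Icc 0 L, R s ∈ Matrix.specialOrthogonalGroup (Fin 3) ℝ
  continuousOn : ContinuousOn R (Icc 0 L)
  start : R 0 = 1
  tangent : ∀ s ∈ Icc 0 L,
    HasDerivWithinAt x (WithLp.toLp 2 (R s *ᵥ eZ.ofLp)) (Icc 0 L) s
  rotation_deriv : ∀ s ∈ Ioo 0 L, ∀ i j, HasDerivAt (fun t => R t i j)
    ((R s * !![0, 0, κ₁ s; 0, 0, κ₂ s; -κ₁ s, -κ₂ s, 0]) i j) s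

/-- A cuspless sub-Riemannian geodesic on `[0, L]`, starting at the unit element of `SE(3)`: the
horizontal lift of a stationary curve. -/
structure IsCusplessGeodesic (β L : ℝ) (x : ℝ → E3) (R : ℝ → Matrix (Fin 3) (Fin 3) ℝ)
    (κ₁ κ₂ : ℝ → ℝ) : Prop where
  stationaryCurve : IsStationaryCurve β L x
  lift : IsHorizontalLift L x R κ₁ κ₂

/-- The first normalized curvature `κ₁ / √(κ ^ 2 + β ^ 2)`, where `κ ^ 2 = κ₁ ^ 2 + κ₂ ^ 2`. -/
def w₁ (β : ℝ) (κ₁ κ₂ : ℝ → ℝ) (s : ℝ) : ℝ :=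
  κ₁ s / Real.sqrt (κ₁ s ^ 2 + κ₂ s ^ 2 + β ^ 2)

/-- The second normalized curvature `κ₂ / √(κ ^ 2 + β ^ 2)`. -/
def w₂ (β : ℝ) (κ₁ κ₂ : ℝ → ℝ) (s : ℝ) : ℝ :=
  κ₂ s / Real.sqrt (κ₁ s ^ 2 + κ₂ s ^ 2 + β ^ 2)

/-- The Wronskian `w₁ w₂' - w₂ w₁'` of the normalized curvatures. -/
def wronskian (β : ℝ) (κ₁ κ₂ : ℝ → ℝ) (s : ℝ) : ℝ :=
  w₁ β κ₁ κ₂ s * deriv (w₂ β κ₁ κ₂) s - w₂ β κ₁ κ₂ s * deriv (w₁ β κ₁ κ₂) s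

end

/-! Write `T` for the tangent, `S = √(κ² + β²)` and `w = T' / S`. The Euler–Lagrange equation
integrates once to a constant force `F`, with `w' = g T - F` and `F · T = β² / S > 0`
(`exists_force`, `exists_force_torque`). The torque `M = x × F + T × w` is constant too. In the
moving frame `w₁, w₂` are the components of `w` and their derivatives are those of `-F`, so the
Wronskian is the constant `W = -M · F`.

If `W = 0`, the normal parts of `w` and `F` are parallel at a point. A vector `n` with constant
frame coefficients that is orthogonal to both there stays orthogonal to both, because `w · n` and `F
· n` solve a linear hyperbolic system. Then `n` is constant and normal to the curve
(`exists_normal`).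

If `W ≠ 0`, put `p = M - x × F = T × w`, so that `T' = S p × T`, and let `T₀ = T 0`. Consider `D =
[x, T, T₀]`, `Q = [F, T, T₀]` and `m = p · T₀`, where brackets are triple products. Here `m' = Q`,
and a first-zero argument, resting on `F · T ≥ 0` and `sign_of_triple_eq_zero`, shows that `W Q > 0`
after the start. A Plücker relation gives `D' Q - D Q' = S m²`, so `D / Q` increases strictly from
its limit `0` and `D` never vanishes (`triple_ne_zero_of_inner_ne_zero`). Coplanarity at a single
`s` thus forces `W = 0`. -/

/-! ### Cross and triple products. -/

theorem cross_apply_zero (u v : E3) : cross u v 0 = u 1 * v 2 - u 2 * v 1 := by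
  simp [cross, cross_apply]

theorem cross_apply_one (u v : E3) : cross u v 1 = u 2 * v 0 - u 0 * v 2 := by
  simp [cross, cross_apply]

theorem cross_apply_two (u v : E3) : cross u v 2 = u 0 * v 1 - u 1 * v 0 := by
  simp [cross, cross_apply]

theorem inner_E3 (u v : E3) : inner ℝ u v = u 0 * v 0 + u 1 * v 1 + u 2 * v 2 := by
  simp [PiLp.inner_apply, Fin.sum_univ_three, mul_comm]

theorem E3.ext_coord {u v : E3} (h0 : u 0 = v 0) (h1 : u 1 = v 1) (h2 : u 2 = v 2) : u = v := by
  ext i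
  fin_cases i <;> assumption

theorem hasDerivAt_E3_iff {f : ℝ → E3} {f' : E3} {t : ℝ} :
    HasDerivAt f f' t ↔ ∀ i, HasDerivAt (fun s => f s i) (f' i) t := by
  simp only [← hasDerivWithinAt_univ]
  rw [hasDerivWithinAt_iff_hasFDerivWithinAt, hasFDerivWithinAt_euclidean]
  exact Iff.rfl

theorem continuousOn_E3_iff {f : ℝ → E3} {s : Set ℝ} :
    ContinuousOn f s ↔ ∀ i, ContinuousOn (fun t => f t i) s := by
  constructor
  · intro h i
    fun_prop
  · intro h
    have : ContinuousOn (fun t => (WithLp.toLp 2 (fun i => f t i) : E3)) s :=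
      (PiLp.continuous_toLp 2 _).comp_continuousOn (continuousOn_pi.2 h)
    exact this

theorem HasDerivAt.cross {f g : ℝ → E3} {f' g' : E3} {t : ℝ} (hf : HasDerivAt f f' t)
    (hg : HasDerivAt g g' t) :
    HasDerivAt (fun s => cross (f s) (g s)) (_root_.cross f' (g t) + _root_.cross (f t) g') t := by
  rw [hasDerivAt_E3_iff] at *
  intro i
  fin_cases i <;> simp [cross_apply_zero, cross_apply_one, cross_apply_two]
  · refine (((hf 1).mul (hg 2)).sub ((hf 2).mul (hg 1))).congr_deriv ?_
    ring
  · refine (((hf 2).mul (hg 0)).sub ((hf 0).mul (hg 2))).congr_deriv ?_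
    ring
  · refine (((hf 0).mul (hg 1)).sub ((hf 1).mul (hg 0))).congr_deriv ?_
    ring

theorem ContinuousOn.cross {f g : ℝ → E3} {s : Set ℝ} (hf : ContinuousOn f s)
    (hg : ContinuousOn g s) : ContinuousOn (fun t => _root_.cross (f t) (g t)) s := by
  rw [continuousOn_E3_iff] at *
  have f0 := hf 0; have f1 := hf 1; have f2 := hf 2
  have g0 := hg 0; have g1 := hg 1; have g2 := hg 2
  intro i
  fin_cases i <;> simp only [cross_apply_zero, cross_apply_one, cross_apply_two, Fin.zero_eta,
    Fin.mk_one, Fin.reduceFinMk] <;> fun_prop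

/-- The scalar triple product. -/
noncomputable def triple (u v w : E3) : ℝ := inner ℝ u (cross v w)

theorem triple_eq (u v w : E3) : triple u v w = u 0 * (v 1 * w 2 - v 2 * w 1)
    + u 1 * (v 2 * w 0 - v 0 * w 2) + u 2 * (v 0 * w 1 - v 1 * w 0) := by
  simp [triple, inner_E3, cross_apply_zero, cross_apply_one, cross_apply_two]

theorem HasDerivAt.triple {f g h : ℝ → E3} {f' g' h' : E3} {t : ℝ} (hf : HasDerivAt f f' t)
    (hg : HasDerivAt g g' t) (hh : HasDerivAt h h' t) :
    HasDerivAt (fun s => _root_.triple (f s) (g s) (h s))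
      (_root_.triple f' (g t) (h t) + _root_.triple (f t) g' (h t)
        + _root_.triple (f t) (g t) h') t := by
  refine (hf.inner ℝ (hg.cross hh)).congr_deriv ?_
  simp only [_root_.triple, inner_add_right]; ring

theorem ContinuousOn.triple {f g h : ℝ → E3} {s : Set ℝ} (hf : ContinuousOn f s)
    (hg : ContinuousOn g s) (hh : ContinuousOn h s) :
    ContinuousOn (fun t => _root_.triple (f t) (g t) (h t)) s :=
  hf.inner (hg.cross hh)

/-! ### The comparison argument for `W ≠ 0`. -/

/-- If `q` starts at zero, `q' = S H` with `S > 0`, and `H` is positive at the start and wherever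
`q` might return to zero for the first time, then `q` stays positive. -/
theorem pos_of_first_zero_increasing {L : ℝ} (hL : 0 < L) {q S H : ℝ → ℝ}
    (hq : ContinuousOn q (Icc 0 L)) (hH : ContinuousOn H (Icc 0 L)) (q0 : q 0 = 0)
    (hS : ∀ t ∈ Ioo 0 L, 0 < S t) (hd : ∀ t ∈ Ioo 0 L, HasDerivAt q (S t * H t) t)
    (H0 : 0 < H 0)
    (hfirst : ∀ s ∈ Ioc 0 L, (∀ t ∈ Ioo 0 s, 0 < q t) → q s = 0 → 0 < H s) :
    ∀ s ∈ Ioc 0 L, 0 < q s := by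
  have mono : ∀ a b, 0 ≤ a → b ≤ L → a ≤ b → (∀ t ∈ Icc a b, 0 < H t) →
      StrictMonoOn q (Icc a b) := by
    intro a b ha hb hab h
    refine strictMonoOn_of_deriv_pos (convex_Icc a b)
      (hq.mono (Icc_subset_Icc ha hb)) ?_
    intro t ht
    rw [interior_Icc] at ht
    have ht' : t ∈ Ioo 0 L := ⟨lt_of_le_of_lt ha ht.1, lt_of_lt_of_le ht.2 hb⟩
    rw [(hd t ht').deriv]
    exact mul_pos (hS t ht') (h t ⟨ht.1.le, ht.2.le⟩)
  obtain ⟨δ, hδ, hδL, hδH⟩ : ∃ δ > 0, δ ≤ L ∧ ∀ t ∈ Icc 0 δ, 0 < H t := by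
    have := (hH 0 ⟨le_rfl, hL.le⟩).eventually (lt_mem_nhds H0)
    obtain ⟨ε, hε, h⟩ := Metric.mem_nhdsWithin_iff.1 this
    refine ⟨min (ε / 2) L, by positivity, min_le_right _ _, fun t ht => h ⟨?_, ht.1, ?_⟩⟩
    · rw [Metric.mem_ball, Real.dist_eq, sub_zero, abs_of_nonneg ht.1]
      have := ht.2.trans (min_le_left _ _)
      linarith
    · exact ht.2.trans (min_le_right _ _)
  have near : ∀ t ∈ Ioc 0 δ, 0 < q t := by
    intro t ht
    have := mono 0 δ le_rfl hδL hδ.le hδH ⟨le_rfl, hδ.le⟩ ⟨ht.1.le, ht.2⟩ ht.1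
    rwa [q0] at this
  by_contra! hbad
  obtain ⟨s₁, hs₁, hqs₁⟩ := hbad
  -- Starting at `δ` excludes the zero of `q` at the origin; the infimum of this closed set is the
  -- first return to zero.
  set B := Icc δ L ∩ q ⁻¹' Iic 0 with hB
  have hBc : IsClosed B :=
    (hq.mono (Icc_subset_Icc hδ.le le_rfl)).preimage_isClosed_of_isClosed isClosed_Icc isClosed_Iic
  have hs₁δ : δ < s₁ := by
    by_contra! h
    exact absurd (near s₁ ⟨hs₁.1, h⟩) (not_lt.2 hqs₁)
  have hBn : B.Nonempty := ⟨s₁, ⟨hs₁δ.le, hs₁.2⟩, hqs₁⟩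
  have hBb : BddBelow B := ⟨δ, fun t ht => ht.1.1⟩
  have hmem := hBc.csInf_mem hBn hBb
  set s := sInf B
  have hpos : ∀ t ∈ Ioo 0 s, 0 < q t := by
    intro t ht
    by_contra! h
    rcases le_or_gt t δ with h1 | h1
    · exact absurd (near t ⟨ht.1, h1⟩) (not_lt.2 h)
    · exact absurd (csInf_le hBb (show t ∈ B from ⟨⟨h1.le, ht.2.le.trans hmem.1.2⟩, h⟩))
        (not_le.2 ht.2)
  have hs0 : 0 < s := lt_of_lt_of_le hδ hmem.1.1
  have hsL : s ≤ L := hmem.1.2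
  have hge : 0 ≤ q s := by
    have hc : ContinuousWithinAt q (Ioo 0 s) s :=
      (hq s ⟨hs0.le, hsL⟩).mono fun t ht => ⟨ht.1.le, ht.2.le.trans hsL⟩
    have : s ∈ closure (Ioo 0 s) := by rw [closure_Ioo hs0.ne]; exact ⟨hs0.le, le_rfl⟩
    have h2 := hc.mem_closure_image this
    have : closure (q '' Ioo 0 s) ⊆ Ici 0 := closure_minimal (by
      rintro _ ⟨t, ht, rfl⟩; exact (hpos t ht).le) isClosed_Ici
    exact this h2
  have hqs : q s = 0 := le_antisymm hmem.2 hge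
  have hHs := hfirst s ⟨hs0, hsL⟩ hpos hqs
  have := (hH s ⟨hs0.le, hsL⟩).eventually (lt_mem_nhds hHs)
  obtain ⟨ε, hε, h⟩ := Metric.mem_nhdsWithin_iff.1 this
  -- On `[a, s]` the factor `H` is positive, so `q` increases strictly to `q s = 0`, against `q a >
  -- 0`.
  set a := max (s - ε / 2) (s / 2)
  have ha : a < s := max_lt (by linarith) (by linarith)
  have ha0 : 0 < a := lt_of_lt_of_le (by linarith) (le_max_right _ _)
  have := mono a s ha0.le hsL ha.le (fun t ht => h ⟨by
    rw [Metric.mem_ball, Real.dist_eq, abs_sub_lt_iff]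
    have := (le_max_left (s - ε / 2) (s / 2)).trans ht.1
    constructor <;> linarith [ht.2], ha0.le.trans ht.1, ht.2.trans hsL⟩)
    ⟨le_rfl, ha.le⟩ ⟨ha.le, le_rfl⟩ ha
  linarith [hpos a ⟨ha0, ha⟩]

theorem inner_cross_cross (p F T : E3) :
    cross p (cross F T) = (inner ℝ p T : ℝ) • F - (inner ℝ p F : ℝ) • T := by
  apply E3.ext_coord <;>
    simp [inner_E3, cross_apply_zero, cross_apply_one, cross_apply_two] <;> ring

theorem triple_cross_left_eq (F p T T₀ : E3) : triple F (cross p T) T₀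
    = inner ℝ F T * inner ℝ p T₀ - inner ℝ p F * inner ℝ T T₀ := by
  simp only [inner_E3, triple_eq, cross_apply_zero, cross_apply_one, cross_apply_two]
  ring

/-- The product of two determinants is the determinant of the mixed Gram matrix, expanded here along
the row of `F`. -/
theorem triple_mul_triple (F T p T₀ : E3) : triple F T p * triple F T T₀ =
    inner ℝ F F * (inner ℝ T T * inner ℝ p T₀ - inner ℝ T T₀ * inner ℝ p T)
    - inner ℝ F T * (inner ℝ F T * inner ℝ p T₀ - inner ℝ T T₀ * inner ℝ p F)
    + inner ℝ F T₀ * (inner ℝ F T * inner ℝ p T - inner ℝ T T * inner ℝ p F) := by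
  simp only [inner_E3, triple_eq]
  ring

theorem inner_cross_cross_left (F T T₀ : E3) : inner ℝ (cross F T) (cross F T₀)
    = inner ℝ F F * inner ℝ T T₀ - (inner ℝ F T : ℝ) * inner ℝ F T₀ := by
  simp only [inner_E3, cross_apply_zero, cross_apply_one, cross_apply_two]
  ring

/-- When `F, T, T₀` are coplanar, `F × T` and `F × T₀` are parallel. The Gram identity and the sign
of `p · T₀` make their inner product positive, so `T` and `T₀` lie on the same side of the line of
`F`. This fixes the sign of the derivative of `[F, T, T₀]` at a possible first zero. -/
theorem sign_of_triple_eq_zero {p F T T₀ : E3} (hpT : inner ℝ p T = (0 : ℝ))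
    (hT : inner ℝ T T = (1 : ℝ)) (hFT : 0 ≤ (inner ℝ F T : ℝ)) (hFT₀ : 0 ≤ (inner ℝ F T₀ : ℝ))
    (hW : (inner ℝ p F : ℝ) ≠ 0) (hQ : triple F T T₀ = 0)
    (hm : 0 < -(inner ℝ p F : ℝ) * inner ℝ p T₀) :
    0 < -(inner ℝ p F : ℝ) * triple F (cross p T) T₀ := by
  have hA : (0 : ℝ) < inner ℝ (cross F T) (cross F T) := by
    rw [real_inner_self_eq_norm_sq]
    refine pow_pos (norm_pos_iff.2 fun h => hW ?_) 2
    have h1 := inner_cross_cross p F T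
    have h0 : cross p (0 : E3) = 0 := by
      apply E3.ext_coord <;> simp [cross_apply_zero, cross_apply_one, cross_apply_two]
    rw [h, h0, hpT, zero_smul, zero_sub, eq_comm, neg_eq_zero, smul_eq_zero] at h1
    rcases h1 with h1 | h1
    · exact h1
    · simp [h1] at hT
  have hF : (0 : ℝ) < inner ℝ F F := by
    rw [real_inner_self_eq_norm_sq]
    refine pow_pos (norm_pos_iff.2 fun h => hW (by simp [h])) 2
  -- Multiplied by `-p · F`, the left side becomes positive, while the factor beside `(F × T) · (F ×
  -- T₀)` becomes `(p · F)² (F · T) ≥ 0`.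
  have hAB : inner ℝ (cross F T) (cross F T) *
      (inner ℝ F F * inner ℝ p T₀ - inner ℝ p F * inner ℝ F T₀) =
      inner ℝ (cross F T) (cross F T₀) * (-inner ℝ p F * inner ℝ F T) := by
    have h := triple_mul_triple F T p T₀
    rw [hQ, hpT, hT] at h
    rw [inner_cross_cross_left, inner_cross_cross_left, hT]
    linear_combination (-inner ℝ F F : ℝ) * h
  have hL := inner_cross_cross_left F T T₀
  rw [triple_cross_left_eq]
  generalize (inner ℝ (cross F T) (cross F T) : ℝ) = A at *
  generalize (inner ℝ (cross F T) (cross F T₀) : ℝ) = B at *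
  generalize (inner ℝ p F : ℝ) = W at *
  generalize (inner ℝ F F : ℝ) = f at *
  generalize (inner ℝ p T₀ : ℝ) = m at *
  generalize (inner ℝ F T₀ : ℝ) = a at *
  generalize (inner ℝ F T : ℝ) = b at *
  generalize (inner ℝ T T₀ : ℝ) = e at *
  have hW2 : 0 < W ^ 2 := by positivity
  have hu : 0 < f * (-W * m) + W ^ 2 * a := by positivity
  have hB : 0 < B := by
    have h1 : 0 < A * (f * (-W * m) + W ^ 2 * a) := mul_pos hA hu
    have h2 : A * (f * (-W * m) + W ^ 2 * a) = B * (W ^ 2 * b) := by linear_combination -W * hAB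
    rw [h2] at h1
    exact pos_of_mul_pos_left h1 (by positivity)
  have h3 : 0 < f * (-W * (b * m - W * e)) := by
    have : f * (-W * (b * m - W * e)) = b * (f * (-W * m)) + W ^ 2 * B + W ^ 2 * (b * a) := by
      linear_combination -W ^ 2 * hL
    rw [this]
    positivity
  exact pos_of_mul_pos_right h3 hF.le

/-- The `2 × 2` Wronskian of `triple x T T₀` and `triple F T T₀`, with `p × T` in place of `T'`,
when `p = M - x × F`. -/
theorem triple_wronskian {x F T T₀ M : E3} (hpT : inner ℝ (M - cross x F) T = (0 : ℝ))
    (hT : inner ℝ T T = (1 : ℝ)) (hM : inner ℝ M T₀ = (0 : ℝ)) :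
    triple x (cross (M - cross x F) T) T₀ * triple F T T₀
      - triple x T T₀ * triple F (cross (M - cross x F) T) T₀
      = inner ℝ (M - cross x F) T₀ ^ 2 := by
  set p := M - cross x F with hp
  have h1 : triple x F T₀ = - inner ℝ p T₀ := by
    rw [hp, inner_sub_left, hM]
    simp only [inner_E3, triple_eq, cross_apply_zero, cross_apply_one, cross_apply_two]
    ring
  have h2 : triple (cross p T) T T₀ = - inner ℝ p T₀ := by
    have : triple (cross p T) T T₀ = inner ℝ p T * inner ℝ T T₀ - inner ℝ T T * inner ℝ p T₀ := by
      simp only [inner_E3, triple_eq, cross_apply_zero, cross_apply_one, cross_apply_two]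
      ring
    rw [this, hpT, hT]; ring
  -- The Plücker relation for four vectors modulo `T₀`; it holds with any vector in place of `p ×
  -- T`.
  have h3 : triple x (cross p T) T₀ * triple F T T₀ - triple x T T₀ * triple F (cross p T) T₀
      = triple x F T₀ * triple (cross p T) T T₀ := by
    generalize cross p T = w
    simp only [triple_eq]
    ring
  rw [h3, h1, h2]; ring

theorem triple_smul_mid (c : ℝ) (u v w : E3) : triple u (c • v) w = c * triple u v w := by
  simp only [triple_eq, PiLp.smul_apply, smul_eq_mul]
  ring

theorem HasDerivAt.triple_mid (F T₀ : E3) {f : ℝ → E3} {f' : E3} {t : ℝ}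
    (hf : HasDerivAt f f' t) :
    HasDerivAt (fun s => _root_.triple F (f s) T₀) (_root_.triple F f' T₀) t := by
  refine ((hasDerivAt_const t F).triple hf (hasDerivAt_const t T₀)).congr_deriv ?_
  simp [triple_eq]

open Filter Topology in
/-- Let `p = M - x × F`, where `x' = T` is a unit vector orthogonal to `p`, and let `T'` be a
positive multiple of `p × T`. If `F` makes an acute angle with `T` and is not orthogonal to `M`,
then `x`, `T` and the initial direction `T 0` are never coplanar. -/
theorem triple_ne_zero_of_inner_ne_zero {L : ℝ} (hL : 0 < L) {F M : E3} {x T : ℝ → E3} {S : ℝ → ℝ}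
    (hxc : ContinuousOn x (Icc 0 L)) (hTc : ContinuousOn T (Icc 0 L))
    (hx : ∀ t ∈ Ioo 0 L, HasDerivAt x (T t) t)
    (hT : ∀ t ∈ Ioo 0 L, HasDerivAt T (S t • cross (M - cross (x t) F) (T t)) t)
    (hS : ∀ t ∈ Ioo 0 L, 0 < S t) (x0 : x 0 = 0)
    (hTT : ∀ t ∈ Icc 0 L, inner ℝ (T t) (T t) = (1 : ℝ))
    (hpT : ∀ t ∈ Icc 0 L, inner ℝ (M - cross (x t) F) (T t) = (0 : ℝ))
    (hFT : ∀ t ∈ Icc 0 L, 0 ≤ (inner ℝ F (T t) : ℝ))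
    (hMF : (inner ℝ M F : ℝ) ≠ 0) :
    ∀ s ∈ Ioc 0 L, triple (x s) (T s) (T 0) ≠ 0 := by
  set p : ℝ → E3 := fun t => M - cross (x t) F with hp
  set W : ℝ := -inner ℝ M F with hWdef
  have hW : W ≠ 0 := neg_ne_zero.2 hMF
  have hpF : ∀ t, inner ℝ (p t) F = (inner ℝ M F : ℝ) := by
    intro t
    simp only [hp, inner_sub_left, inner_E3, cross_apply_zero, cross_apply_one, cross_apply_two]
    ring
  have hzero : (0 : ℝ) ∈ Icc 0 L := ⟨le_rfl, hL.le⟩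
  have hp0 : p 0 = M := by
    apply E3.ext_coord <;> simp [hp, x0, cross_apply_zero, cross_apply_one, cross_apply_two]
  have hMT : inner ℝ M (T 0) = (0 : ℝ) := by rw [← hp0]; exact hpT 0 hzero
  have hpc : ContinuousOn p (Icc 0 L) := continuousOn_const.sub (hxc.cross continuousOn_const)
  have hwc : ContinuousOn (fun t => cross (p t) (T t)) (Icc 0 L) := hpc.cross hTc
  have hcT0 : ContinuousOn (fun _ : ℝ => T 0) (Icc 0 L) := continuousOn_const
  set Q : ℝ → ℝ := fun t => triple F (T t) (T 0) with hQ
  set h : ℝ → ℝ := fun t => triple F (cross (p t) (T t)) (T 0) with hh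
  set m : ℝ → ℝ := fun t => inner ℝ (p t) (T 0) with hm
  set D : ℝ → ℝ := fun t => triple (x t) (T t) (T 0) with hD
  set d : ℝ → ℝ := fun t => triple (x t) (cross (p t) (T t)) (T 0) with hd
  have hQc : ContinuousOn Q (Icc 0 L) := continuousOn_const.triple hTc hcT0
  have hhc : ContinuousOn h (Icc 0 L) := continuousOn_const.triple hwc hcT0
  have hmc : ContinuousOn m (Icc 0 L) := hpc.inner hcT0
  have hDc : ContinuousOn D (Icc 0 L) := hxc.triple hTc hcT0
  have hdc : ContinuousOn d (Icc 0 L) := hxc.triple hwc hcT0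
  have hQ' : ∀ t ∈ Ioo 0 L, HasDerivAt Q (S t * h t) t := by
    intro t ht
    refine ((hT t ht).triple_mid F (T 0)).congr_deriv ?_
    rw [triple_smul_mid]
  have hD' : ∀ t ∈ Ioo 0 L, HasDerivAt D (S t * d t) t := by
    intro t ht
    refine ((hx t ht).triple (hT t ht) (hasDerivAt_const t (T 0))).congr_deriv ?_
    rw [triple_smul_mid]
    simp only [triple_eq, hd, PiLp.zero_apply]
    ring
  have hm' : ∀ t ∈ Ioo 0 L, HasDerivAt m (Q t) t := by
    intro t ht
    have h1 := ((hasDerivAt_const t M).sub ((hx t ht).cross (hasDerivAt_const t F))).inner ℝ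
      (hasDerivAt_const t (T 0))
    refine h1.congr_deriv ?_
    simp only [hQ, triple_eq, inner_E3, cross_apply_zero, cross_apply_one, cross_apply_two,
      PiLp.zero_apply, PiLp.sub_apply, PiLp.add_apply]
    ring
  have hh0 : h 0 = W := by
    have : h 0 = _ := triple_cross_left_eq F (p 0) (T 0) (T 0)
    rw [this, hTT 0 hzero, hp0, hMT, hWdef]; ring
  have hQ0 : Q 0 = 0 := by simp only [hQ, triple_eq]; ring
  have hD0 : D 0 = 0 := by simp only [hD, triple_eq, x0, PiLp.zero_apply]; ring
  have hm0 : m 0 = 0 := by simp only [hm, hp0, hMT]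
  -- Since `m' = Q` and `m 0 = 0`, the sign of `W Q` passes to `W m`.
  have hWm : ∀ s ∈ Ioc 0 L, (∀ t ∈ Ioo 0 s, 0 < W * Q t) → 0 < W * m s := by
    intro s hs hpos
    have : StrictMonoOn (fun t => W * m t) (Icc 0 s) := by
      refine strictMonoOn_of_deriv_pos (convex_Icc 0 s)
        (continuousOn_const.mul (hmc.mono (Icc_subset_Icc le_rfl hs.2))) ?_
      intro t ht
      rw [interior_Icc] at ht
      rw [((hm' t ⟨ht.1, ht.2.trans_le hs.2⟩).const_mul W).deriv]
      exact hpos t ht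
    have := this ⟨le_rfl, hs.1.le⟩ ⟨hs.1.le, le_rfl⟩ hs.1
    simpa [hm0] using this
  -- Initially `W h = W² > 0`; at a first zero of `Q` the sign lemma, fed with `W m > 0`, gives `W h
  -- > 0` again.
  have hWQ : ∀ s ∈ Ioc 0 L, 0 < W * Q s := by
    refine pos_of_first_zero_increasing hL (q := fun s => W * Q s) (S := S)
      (H := fun s => W * h s) (continuousOn_const.mul hQc) (continuousOn_const.mul hhc)
      (by simp [hQ0]) hS ?_ ?_ ?_
    · intro t ht
      exact ((hQ' t ht).const_mul W).congr_deriv (by ring)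
    · simp only [hh0]
      exact mul_self_pos.2 hW
    · intro s hs hpos hQs
      have hs' : s ∈ Icc 0 L := Ioc_subset_Icc_self hs
      have hms := hWm s hs hpos
      have hQs' : Q s = 0 := by simpa [hW] using hQs
      have := sign_of_triple_eq_zero (p := p s) (F := F) (T₀ := T 0) (hpT s hs') (hTT s hs')
        (hFT s hs') (hFT 0 hzero) (by rw [hpF]; exact hMF) hQs' (by rw [hpF]; exact hms)
      rwa [hpF] at this
  have hQne : ∀ s ∈ Ioc 0 L, Q s ≠ 0 := fun s hs => right_ne_zero_of_mul (hWQ s hs).ne'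
  have hmne : ∀ s ∈ Ioo 0 L, m s ≠ 0 := fun s hs => right_ne_zero_of_mul
    (hWm s (Ioo_subset_Ioc_self hs) fun t ht => hWQ t ⟨ht.1, (ht.2.trans hs.2).le⟩).ne'
  have hmono : StrictMonoOn (fun t => D t / Q t) (Ioc 0 L) := by
    refine strictMonoOn_of_deriv_pos (convex_Ioc 0 L)
      ((hDc.mono Ioc_subset_Icc_self).div (hQc.mono Ioc_subset_Icc_self) hQne) ?_
    intro t ht
    rw [interior_Ioc] at ht
    have ht' := Ioo_subset_Icc_self ht
    rw [((hD' t ht).fun_div (hQ' t ht) (hQne t (Ioo_subset_Ioc_self ht))).deriv]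
    have hPl : d t * Q t - D t * h t = m t ^ 2 := triple_wronskian (hpT t ht') (hTT t ht') hMT
    have : S t * d t * Q t - D t * (S t * h t) = S t * m t ^ 2 := by rw [← hPl]; ring
    rw [this]
    have := hS t ht
    have := hmne t ht
    have := hQne t (Ioo_subset_Ioc_self ht)
    positivity
  -- The quotient is `0 / 0` at the start, and `S` may blow up there. In l'Hôpital's rule `S`
  -- cancels, leaving `d / h → 0 / W`.
  have hlim : Tendsto (fun t => D t / Q t) (𝓝[>] 0) (𝓝 0) := by
    have hIcc : 𝓝[>] (0 : ℝ) ≤ 𝓝[Icc 0 L] 0 := by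
      rw [← nhdsWithin_Ioc_eq_nhdsGT hL]
      exact nhdsWithin_mono _ Ioc_subset_Icc_self
    have hl : ∀ {f : ℝ → ℝ}, ContinuousOn f (Icc 0 L) → Tendsto f (𝓝[>] 0) (𝓝 (f 0)) :=
      fun hf => (hf 0 hzero).mono_left hIcc
    have hmem : ∀ᶠ t in 𝓝[>] (0 : ℝ), t ∈ Ioo 0 L := Ioo_mem_nhdsGT hL
    have hh0' : ∀ᶠ t in 𝓝[>] (0 : ℝ), h t ≠ 0 := (hl hhc).eventually_ne (by rwa [hh0])
    refine HasDerivAt.lhopital_zero_nhdsGT (f' := fun t => S t * d t) (g' := fun t => S t * h t)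
      (hmem.mono hD') (hmem.mono hQ') ?_ ?_ ?_ ?_
    · filter_upwards [hmem, hh0'] with t ht h1
      exact mul_ne_zero (hS t ht).ne' h1
    · simpa only [hD0] using hl hDc
    · simpa only [hQ0] using hl hQc
    · have hd0 : d 0 = 0 := by simp only [hd, triple_eq, x0, PiLp.zero_apply]; ring
      have := (hl hdc).div (hl hhc) (by rwa [hh0])
      rw [hd0, zero_div] at this
      refine this.congr' ?_
      filter_upwards [hmem] with t ht
      simp only [Pi.div_apply]
      rw [mul_div_mul_left _ _ (hS t ht).ne']
  intro s hs hDs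
  have h2 : s / 2 ∈ Ioc 0 L := ⟨by linarith [hs.1], by linarith [hs.1, hs.2]⟩
  have h3 := hmono h2 hs (by linarith [hs.1])
  have h4 : 0 ≤ D (s / 2) / Q (s / 2) := by
    refine le_of_tendsto hlim ?_
    filter_upwards [Ioo_mem_nhdsGT h2.1] with t ht
    exact (hmono ⟨ht.1, ht.2.le.trans h2.2⟩ h2 ht.2).le
  have : D s = 0 := hDs
  simp only [this, zero_div] at h3
  linarith

/-! ### The Lagrangian and differentiation of the energy. -/

/-- The integrand of the energy, as a function of the velocity and the acceleration. -/
noncomputable def lagrangian (β : ℝ) (q : E3 × E3) : ℝ :=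
  Real.sqrt ((‖cross q.1 q.2‖ / ‖q.1‖ ^ 3) ^ 2 + β ^ 2) * ‖q.1‖

theorem energy_eq (β L : ℝ) (y : ℝ → E3) :
    energy β L y = ∫ t in (0 : ℝ)..L, lagrangian β (deriv y t, deriv (deriv y) t) := rfl

theorem norm_cross_sq (a b : E3) :
    ‖cross a b‖ ^ 2 = ‖a‖ ^ 2 * ‖b‖ ^ 2 - (inner ℝ a b : ℝ) ^ 2 := by
  simp only [← real_inner_self_eq_norm_sq, inner_E3, cross_apply_zero, cross_apply_one,
    cross_apply_two]
  ring

/-- Only squared norms and inner products remain, which removes the apparent singularity of `‖cross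
q.1 q.2‖` at zero curvature. -/
theorem lagrangian_eq (β : ℝ) (q : E3 × E3) : lagrangian β q =
    Real.sqrt ((‖q.1‖ ^ 2 * ‖q.2‖ ^ 2 - (inner ℝ q.1 q.2 : ℝ) ^ 2) / (‖q.1‖ ^ 2) ^ 3 + β ^ 2)
      * Real.sqrt (‖q.1‖ ^ 2) := by
  rw [lagrangian, div_pow, norm_cross_sq, Real.sqrt_sq (norm_nonneg _), ← pow_mul, ← pow_mul]

theorem lagrangian_radicand_pos {β : ℝ} (hβ : 0 < β) (q : E3 × E3) :
    0 < (‖q.1‖ ^ 2 * ‖q.2‖ ^ 2 - (inner ℝ q.1 q.2 : ℝ) ^ 2) / (‖q.1‖ ^ 2) ^ 3 + β ^ 2 := by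
  rw [← norm_cross_sq]
  positivity

theorem contDiffAt_lagrangian {β : ℝ} (hβ : 0 < β) {q : E3 × E3} (hq : q.1 ≠ 0) :
    ContDiffAt ℝ ∞ (lagrangian β) q := by
  have : lagrangian β = fun q : E3 × E3 => Real.sqrt ((‖q.1‖ ^ 2 * ‖q.2‖ ^ 2
      - (inner ℝ q.1 q.2 : ℝ) ^ 2) / (‖q.1‖ ^ 2) ^ 3 + β ^ 2) * Real.sqrt (‖q.1‖ ^ 2) :=
    funext (lagrangian_eq β)
  rw [this]
  have h1 : ContDiffAt ℝ ∞ (fun q : E3 × E3 => ‖q.1‖ ^ 2) q := contDiffAt_fst.norm_sq ℝ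
  have h2 : ContDiffAt ℝ ∞ (fun q : E3 × E3 => ‖q.2‖ ^ 2) q := contDiffAt_snd.norm_sq ℝ
  have h3 : ContDiffAt ℝ ∞ (fun q : E3 × E3 => (inner ℝ q.1 q.2 : ℝ)) q :=
    contDiffAt_fst.inner ℝ contDiffAt_snd
  have hn : ‖q.1‖ ^ 2 ≠ 0 := pow_ne_zero 2 (norm_ne_zero_iff.2 hq)
  exact (((((h1.mul h2).sub (h3.pow 2)).div (h1.pow 3) (pow_ne_zero 3 hn)).add
    contDiffAt_const).sqrt (lagrangian_radicand_pos hβ q).ne').mul (h1.sqrt hn)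

/-- Differentiate along a line through `(a, b)`. The squared inner product contributes nothing
because `a ⊥ b`; the factor `-2` combines `+1` from `‖a‖²` with `-3` from `(‖a‖²)³`. -/
theorem fderiv_lagrangian {β : ℝ} (hβ : 0 < β) {a b : E3} (ha : ‖a‖ = 1)
    (hab : inner ℝ a b = (0 : ℝ)) (h l : E3) :
    fderiv ℝ (lagrangian β) (a, b) (h, l) =
      (Real.sqrt (‖b‖ ^ 2 + β ^ 2) - 2 * ‖b‖ ^ 2 / Real.sqrt (‖b‖ ^ 2 + β ^ 2)) * inner ℝ a h
        + inner ℝ ((Real.sqrt (‖b‖ ^ 2 + β ^ 2))⁻¹ • b) l := by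
  have ha0 : a ≠ 0 := by rintro rfl; simp at ha
  have hA : HasDerivAt (fun ε : ℝ => a + ε • h) h 0 := by
    simpa using ((hasDerivAt_id (0 : ℝ)).smul_const h).const_add a
  have hB : HasDerivAt (fun ε : ℝ => b + ε • l) l 0 := by
    simpa using ((hasDerivAt_id (0 : ℝ)).smul_const l).const_add b
  have hd : HasFDerivAt (lagrangian β) (fderiv ℝ (lagrangian β) (a, b)) (a + (0 : ℝ) • h,
      b + (0 : ℝ) • l) := by
    simpa using ((contDiffAt_lagrangian hβ (q := (a, b)) ha0).differentiableAt
      (by simp)).hasFDerivAt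
  have h1 := hd.comp_hasDerivAt (0 : ℝ) (hA.prodMk hB)
  refine h1.unique ?_
  have hA2 := hA.norm_sq
  have hB2 := hB.norm_sq
  have hC := (hA.inner ℝ hB).fun_pow 2
  have hS : (‖b‖ ^ 2 + β ^ 2) ≠ 0 := by positivity
  have key := ((((hA2.fun_mul hB2).fun_sub hC).fun_div (hA2.fun_pow 3) (by simp [ha])).add_const
    (β ^ 2)).sqrt (by simpa [ha, hab] using hS)
  have key2 := key.fun_mul (hA2.sqrt (by simp [ha]))
  have hfun : lagrangian β ∘ (fun ε : ℝ => (a + ε • h, b + ε • l)) = fun ε : ℝ =>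
      Real.sqrt ((‖a + ε • h‖ ^ 2 * ‖b + ε • l‖ ^ 2 - (inner ℝ (a + ε • h) (b + ε • l) : ℝ) ^ 2)
        / (‖a + ε • h‖ ^ 2) ^ 3 + β ^ 2) * Real.sqrt (‖a + ε • h‖ ^ 2) := by
    funext ε
    simp only [Function.comp, lagrangian_eq]
  rw [hfun]
  refine key2.congr_deriv ?_
  have hSp : 0 < Real.sqrt (‖b‖ ^ 2 + β ^ 2) := Real.sqrt_pos.2 (by positivity)
  simp only [zero_smul, add_zero, ha, hab, inner_smul_left, RCLike.conj_to_real, one_pow, one_mul,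
    div_one, Real.sqrt_one, mul_one]
  simp
  field_simp
  ring

theorem aestronglyMeasurable_uIoc_of_continuousOn_Ioo {L : ℝ} (hL : 0 < L) {f : ℝ → ℝ}
    (hf : ContinuousOn f (Ioo 0 L)) :
    AEStronglyMeasurable f (volume.restrict (uIoc 0 L)) := by
  rw [uIoc_of_le hL.le, ← Measure.restrict_congr_set Ioo_ae_eq_Ioc]
  exact hf.aestronglyMeasurable measurableSet_Ioo

theorem ae_mem_Ioo_of_mem_uIoc {L : ℝ} (hL : 0 < L) :
    ∀ᵐ t ∂(volume : Measure ℝ), t ∈ uIoc 0 L → t ∈ Ioo 0 L := by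
  have : ∀ᵐ t ∂(volume : Measure ℝ), t ≠ L := by simp [ae_iff]
  filter_upwards [this] with t ht h
  rw [uIoc_of_le hL.le] at h
  exact ⟨h.1, lt_of_le_of_ne h.2 ht⟩

-- The variation lives on `[a, b]`, where compactness bounds the derivative in `ε`; elsewhere that
-- derivative is zero. Near the ends, where the curvature may be unbounded, integrability of the
-- unperturbed integrand is enough.
open Filter Topology in
theorem hasDerivAt_integral_lagrangian {β L a b : ℝ} (hβ : 0 < β) (hL : 0 < L) (ha : 0 < a)
    (hb : b < L) {T k h l : ℝ → E3} (hT : ContinuousOn T (Ioo 0 L)) (hk : ContinuousOn k (Ioo 0 L))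
    (hT1 : ∀ t ∈ Ioo 0 L, ‖T t‖ = 1) (hh : Continuous h) (hl : Continuous l)
    (hh0 : ∀ t, t ∉ Icc a b → h t = 0) (hl0 : ∀ t, t ∉ Icc a b → l t = 0)
    (hint : IntervalIntegrable (fun t => lagrangian β (T t, k t)) volume 0 L) :
    HasDerivAt (fun ε : ℝ => ∫ t in (0 : ℝ)..L, lagrangian β (T t + ε • h t, k t + ε • l t))
      (∫ t in (0 : ℝ)..L, fderiv ℝ (lagrangian β) (T t, k t) (h t, l t)) 0 := by
  have hab : Icc a b ⊆ Ioo 0 L := fun t ht => ⟨ha.trans_le ht.1, ht.2.trans_lt hb⟩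
  obtain ⟨C, hC⟩ := isCompact_Icc.exists_bound_of_continuousOn (s := Icc a b) hh.continuousOn
  have hC0 : 0 < |C| + 1 := by positivity
  -- This makes `‖ε • h t‖ ≤ 1 / 2 < ‖T t‖` on `[a, b]`, so the perturbed velocity stays nonzero.
  set δ : ℝ := 1 / (2 * (|C| + 1)) with hδ
  have hδ0 : 0 < δ := by positivity
  have hne : ∀ ε ∈ Icc (-δ) δ, ∀ t ∈ Ioo 0 L, T t + ε • h t ≠ 0 := by
    intro ε hε t ht h0
    by_cases htab : t ∈ Icc a b
    · have h1 : ‖T t‖ = ‖ε • h t‖ := by rw [eq_neg_of_add_eq_zero_left h0, norm_neg]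
      rw [hT1 t ht, norm_smul, Real.norm_eq_abs] at h1
      have h2 : |ε| * ‖h t‖ ≤ δ * (|C| + 1) :=
        mul_le_mul (abs_le.2 hε) ((hC t htab).trans ((le_abs_self C).trans (by linarith)))
          (norm_nonneg _) hδ0.le
      have h3 : δ * (|C| + 1) = 1 / 2 := by rw [hδ]; field_simp
      linarith
    · rw [hh0 t htab, smul_zero, add_zero] at h0
      have := hT1 t ht
      simp [h0] at this
  have hpt : ContinuousOn (fun p : ℝ × ℝ => (T p.2 + p.1 • h p.2, k p.2 + p.1 • l p.2))
      (univ ×ˢ Ioo 0 L) := by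
    have h1 : ContinuousOn (fun p : ℝ × ℝ => T p.2) (univ ×ˢ Ioo 0 L) :=
      hT.comp continuousOn_snd fun p hp => hp.2
    have h2 : ContinuousOn (fun p : ℝ × ℝ => k p.2) (univ ×ˢ Ioo 0 L) :=
      hk.comp continuousOn_snd fun p hp => hp.2
    exact (h1.add (by fun_prop)).prodMk (h2.add (by fun_prop))
  have hsub : Icc (-δ) δ ×ˢ Ioo 0 L ⊆ univ ×ˢ Ioo 0 L := prod_mono_left (subset_univ _)
  obtain ⟨G, hG⟩ : ∃ G : ℝ → ℝ → ℝ, ∀ ε t,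
      G ε t = lagrangian β (T t + ε • h t, k t + ε • l t) := ⟨_, fun _ _ => rfl⟩
  obtain ⟨G', hG'⟩ : ∃ G' : ℝ → ℝ → ℝ, ∀ ε t,
      G' ε t = fderiv ℝ (lagrangian β) (T t + ε • h t, k t + ε • l t) (h t, l t) :=
    ⟨_, fun _ _ => rfl⟩
  have hF : ContinuousOn (fun p : ℝ × ℝ => G p.1 p.2) (Icc (-δ) δ ×ˢ Ioo 0 L) := by
    simp only [hG]
    intro p hp
    exact (contDiffAt_lagrangian hβ
      (q := (T p.2 + p.1 • h p.2, k p.2 + p.1 • l p.2))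
      (hne p.1 hp.1 p.2 hp.2)).continuousAt.comp_continuousWithinAt
      (f := fun p : ℝ × ℝ => (T p.2 + p.1 • h p.2, k p.2 + p.1 • l p.2)) (hpt.mono hsub p hp)
  have hF' : ContinuousOn (fun p : ℝ × ℝ => G' p.1 p.2) (Icc (-δ) δ ×ˢ Ioo 0 L) := by
    simp only [hG']
    refine ContinuousOn.clm_apply ?_ (by fun_prop)
    intro p hp
    exact (((contDiffAt_lagrangian hβ
      (q := (T p.2 + p.1 • h p.2, k p.2 + p.1 • l p.2))
      (hne p.1 hp.1 p.2 hp.2)).fderiv_right (m := 0) (by simp))).continuousAt.comp_continuousWithinAt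
      (f := fun p : ℝ × ℝ => (T p.2 + p.1 • h p.2, k p.2 + p.1 • l p.2)) (hpt.mono hsub p hp)
  obtain ⟨B, hB⟩ := (isCompact_Icc.prod isCompact_Icc).exists_bound_of_continuousOn
    (s := Icc (-δ) δ ×ˢ Icc a b) (hF'.mono (prod_mono_right hab))
  have hslice : ∀ ε ∈ Icc (-δ) δ, MapsTo (fun t : ℝ => (ε, t)) (Ioo 0 L)
      (Icc (-δ) δ ×ˢ Ioo 0 L) := fun ε hε t ht => ⟨hε, ht⟩
  have hδmem : Icc (-δ) δ ∈ 𝓝 (0 : ℝ) := Icc_mem_nhds (by linarith) hδ0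
  have hint0 : IntervalIntegrable (G 0) volume 0 L := by
    refine hint.congr fun t _ => ?_
    simp [hG]
  have hslice' : ∀ {g : ℝ → ℝ → ℝ}, ContinuousOn (fun p : ℝ × ℝ => g p.1 p.2)
      (Icc (-δ) δ ×ˢ Ioo 0 L) → ∀ ε ∈ Icc (-δ) δ, ContinuousOn (g ε) (Ioo 0 L) :=
    fun hg ε hε => hg.comp (by fun_prop) (hslice ε hε)
  have key := intervalIntegral.hasDerivAt_integral_of_dominated_loc_of_deriv_le (μ := volume)
    (a := 0) (b := L) (x₀ := (0 : ℝ)) (s := Icc (-δ) δ) (bound := fun _ => |B|)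
    (F := G) (F' := G') hδmem ?_ hint0 ?_ ?_ intervalIntegrable_const ?_
  · simpa [hG, hG'] using key.2
  · filter_upwards [hδmem] with ε hε
    exact aestronglyMeasurable_uIoc_of_continuousOn_Ioo hL (hslice' hF ε hε)
  · exact aestronglyMeasurable_uIoc_of_continuousOn_Ioo hL (hslice' hF' 0 ⟨by linarith, hδ0.le⟩)
  · refine Filter.Eventually.of_forall fun t _ ε hε => ?_
    by_cases htab : t ∈ Icc a b
    · exact (hB (ε, t) ⟨hε, htab⟩).trans (le_abs_self B)
    · have : ((h t, l t) : E3 × E3) = 0 := by rw [hh0 t htab, hl0 t htab]; rfl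
      rw [hG', this, map_zero, norm_zero]
      exact abs_nonneg B
  · filter_upwards [ae_mem_Ioo_of_mem_uIoc hL] with t ht htu ε hε
    simp only [hG, hG']
    have hA : HasDerivAt (fun ε : ℝ => T t + ε • h t) (h t) ε := by
      simpa using ((hasDerivAt_id ε).smul_const (h t)).const_add (T t)
    have hB : HasDerivAt (fun ε : ℝ => k t + ε • l t) (l t) ε := by
      simpa using ((hasDerivAt_id ε).smul_const (l t)).const_add (k t)
    have hd := ((contDiffAt_lagrangian hβ (q := (T t + ε • h t, k t + ε • l t))
      (hne ε hε t (ht htu))).differentiableAt (by simp)).hasFDerivAt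
    exact hd.comp_hasDerivAt ε (hA.prodMk hB)

theorem exists_Icc_of_isCompact_subset_Ioo {L : ℝ} (hL : 0 < L) {K : Set ℝ} (hK : IsCompact K)
    (hKL : K ⊆ Ioo 0 L) : ∃ a b, 0 < a ∧ a < b ∧ b < L ∧ K ⊆ Ioo a b := by
  -- The extra point covers the case of empty `K`.
  have hK' : IsCompact (insert (L / 2) K) := hK.insert _
  have hne : (insert (L / 2) K).Nonempty := ⟨_, mem_insert _ _⟩
  have hsub : insert (L / 2) K ⊆ Ioo 0 L :=
    insert_subset ⟨by linarith, by linarith⟩ hKL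
  obtain ⟨m, hm, hmin⟩ := hK'.exists_isLeast hne
  obtain ⟨M, hM, hmax⟩ := hK'.exists_isGreatest hne
  have h1 := (hsub hm).1
  have h2 := (hsub hM).2
  have h3 := hmin hM
  refine ⟨m / 2, (M + L) / 2, by linarith, by linarith, by linarith, fun t ht => ?_⟩
  have h4 := hmin (mem_insert_of_mem _ ht)
  have h5 := hmax (mem_insert_of_mem _ ht)
  exact ⟨by linarith, by linarith⟩

/-! ### The Euler–Lagrange equation. -/

namespace IsStationaryCurve

variable {β L : ℝ} {x : ℝ → E3}

theorem contDiffOn_deriv (hx : IsStationaryCurve β L x) : ContDiffOn ℝ ∞ (deriv x) (Ioo 0 L) :=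
  hx.contDiffOn_Ioo.deriv_of_isOpen isOpen_Ioo (by simp)

theorem contDiffOn_deriv_deriv (hx : IsStationaryCurve β L x) :
    ContDiffOn ℝ ∞ (deriv (deriv x)) (Ioo 0 L) :=
  hx.contDiffOn_deriv.deriv_of_isOpen isOpen_Ioo (by simp)

theorem derivWithin_eq_deriv {t : ℝ} (ht : t ∈ Ioo 0 L) : derivWithin x (Icc 0 L) t = deriv x t :=
  derivWithin_of_mem_nhds (Icc_mem_nhds ht.1 ht.2)

theorem hasDerivAt (hx : IsStationaryCurve β L x) {t : ℝ} (ht : t ∈ Ioo 0 L) :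
    HasDerivAt x (deriv x t) t :=
  ((hx.contDiffOn_Ioo.contDiffAt (isOpen_Ioo.mem_nhds ht)).differentiableAt (by simp)).hasDerivAt

theorem hasDerivAt_deriv (hx : IsStationaryCurve β L x) {t : ℝ} (ht : t ∈ Ioo 0 L) :
    HasDerivAt (deriv x) (deriv (deriv x) t) t :=
  ((hx.contDiffOn_deriv.contDiffAt (isOpen_Ioo.mem_nhds ht)).differentiableAt
    (by simp)).hasDerivAt

theorem norm_deriv (hx : IsStationaryCurve β L x) {t : ℝ} (ht : t ∈ Ioo 0 L) :
    ‖deriv x t‖ = 1 := by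
  rw [← derivWithin_eq_deriv ht]
  exact hx.arcLength t (Ioo_subset_Icc_self ht)

theorem inner_deriv_deriv_deriv (hx : IsStationaryCurve β L x) {t : ℝ} (ht : t ∈ Ioo 0 L) :
    inner ℝ (deriv x t) (deriv (deriv x) t) = (0 : ℝ) := by
  have h1 := (hx.hasDerivAt_deriv ht).norm_sq
  have h2 : (fun s => ‖deriv x s‖ ^ 2) =ᶠ[nhds t] fun _ => 1 := by
    filter_upwards [isOpen_Ioo.mem_nhds ht] with s hs
    rw [hx.norm_deriv hs, one_pow]
  have h3 := h1.unique ((hasDerivAt_const t (1 : ℝ)).congr_of_eventuallyEq h2)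
  linarith

theorem absCurvature_eq (hx : IsStationaryCurve β L x) {t : ℝ} (ht : t ∈ Ioo 0 L) :
    absCurvature x t = ‖deriv (deriv x) t‖ := by
  have h := norm_cross_sq (deriv x t) (deriv (deriv x) t)
  rw [hx.norm_deriv ht, hx.inner_deriv_deriv_deriv ht] at h
  rw [absCurvature, hx.norm_deriv ht, one_pow, div_one]
  exact (sq_eq_sq₀ (norm_nonneg _) (norm_nonneg _)).1 (by linarith)

theorem lagrangian_eq (hx : IsStationaryCurve β L x) {t : ℝ} (ht : t ∈ Ioo 0 L) :
    lagrangian β (deriv x t, deriv (deriv x) t)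
      = Real.sqrt (‖deriv (deriv x) t‖ ^ 2 + β ^ 2) := by
  rw [← hx.absCurvature_eq ht, lagrangian, absCurvature]
  simp [hx.norm_deriv ht]

theorem intervalIntegrable_lagrangian (hx : IsStationaryCurve β L x) (hβ : 0 < β) (hL : 0 < L) :
    IntervalIntegrable (fun t => lagrangian β (deriv x t, deriv (deriv x) t)) volume 0 L := by
  rw [intervalIntegrable_iff_integrableOn_Ioo_of_le hL.le]
  -- The dominating function comes from `√(κ² + β²) ≤ κ + β`.
  have h1 : IntegrableOn (fun t => absCurvature x t + β) (Ioo 0 L) :=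
    hx.integrable_curvature.add (integrableOn_const (by simp))
  have hc : ContinuousOn (fun t => Real.sqrt (‖deriv (deriv x) t‖ ^ 2 + β ^ 2)) (Ioo 0 L) := by
    have := hx.contDiffOn_deriv_deriv.continuousOn
    fun_prop
  refine Integrable.mono' h1 ((hc.congr fun t ht => hx.lagrangian_eq ht).aestronglyMeasurable
    measurableSet_Ioo) ?_
  filter_upwards [ae_restrict_mem measurableSet_Ioo] with t ht
  rw [hx.lagrangian_eq ht, hx.absCurvature_eq ht, Real.norm_of_nonneg (Real.sqrt_nonneg _)]
  refine Real.sqrt_le_iff.2 ⟨by positivity, ?_⟩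
  nlinarith [mul_nonneg (norm_nonneg (deriv (deriv x) t)) hβ.le]

/-- The weak Euler–Lagrange equation. -/
theorem integral_first_variation (hx : IsStationaryCurve β L x) (hβ : 0 < β) (hL : 0 < L)
    {a b : ℝ} (ha : 0 < a) (hb : b < L) {v : ℝ → E3} (hv : ContDiff ℝ ∞ v)
    (hvab : tsupport v ⊆ Ioo a b) :
    ∫ t in (0 : ℝ)..L, ((Real.sqrt (‖deriv (deriv x) t‖ ^ 2 + β ^ 2)
        - 2 * ‖deriv (deriv x) t‖ ^ 2 / Real.sqrt (‖deriv (deriv x) t‖ ^ 2 + β ^ 2))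
          * inner ℝ (deriv x t) (deriv v t)
        + inner ℝ ((Real.sqrt (‖deriv (deriv x) t‖ ^ 2 + β ^ 2))⁻¹ • deriv (deriv x) t)
          (deriv (deriv v) t)) = 0 := by
  have hsub : Ioo a b ⊆ Ioo 0 L := Ioo_subset_Ioo ha.le hb.le
  have hv1 : ContDiff ℝ ∞ (deriv v) := (contDiff_infty_iff_deriv.1 hv).2
  have hv2 : ContDiff ℝ ∞ (deriv (deriv v)) := (contDiff_infty_iff_deriv.1 hv1).2
  have hs1 : tsupport (deriv v) ⊆ tsupport v := tsupport_deriv_subset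
  have hs2 : tsupport (deriv (deriv v)) ⊆ tsupport v := tsupport_deriv_subset.trans hs1
  have hcs : HasCompactSupport v := isCompact_Icc.of_isClosed_subset (isClosed_tsupport v)
    (hvab.trans Ioo_subset_Icc_self)
  have hz : ∀ {f : ℝ → E3}, tsupport f ⊆ tsupport v → ∀ t, t ∉ Icc a b → f t = 0 := by
    intro f hf t ht
    exact image_eq_zero_of_notMem_tsupport fun h => ht (Ioo_subset_Icc_self (hvab (hf h)))
  have h1 := hasDerivAt_integral_lagrangian hβ hL ha hb hx.contDiffOn_deriv.continuousOn
    hx.contDiffOn_deriv_deriv.continuousOn (fun t ht => hx.norm_deriv ht) hv1.continuous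
    hv2.continuous (hz hs1) (hz hs2) (hx.intervalIntegrable_lagrangian hβ hL)
  have h2 := hx.stationary v hv hcs (hvab.trans hsub)
  have hfun : (fun ε : ℝ => energy β L fun t => x t + ε • v t) = fun ε : ℝ =>
      ∫ t in (0 : ℝ)..L, lagrangian β
        (deriv x t + ε • deriv v t, deriv (deriv x) t + ε • deriv (deriv v) t) := by
    funext ε
    rw [energy_eq]
    refine intervalIntegral.integral_congr_ae ?_
    filter_upwards [ae_mem_Ioo_of_mem_uIoc hL] with t ht htu
    have hd : ∀ s ∈ Ioo 0 L, deriv (fun t => x t + ε • v t) s = deriv x s + ε • deriv v s :=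
      fun s hs => ((hx.hasDerivAt hs).add
        (((hv.differentiable (by simp)) s).hasDerivAt.const_smul ε)).deriv
    have hdd : deriv (deriv fun t => x t + ε • v t) t
        = deriv (deriv x) t + ε • deriv (deriv v) t := by
      have : (deriv fun t => x t + ε • v t) =ᶠ[nhds t] fun s => deriv x s + ε • deriv v s := by
        filter_upwards [isOpen_Ioo.mem_nhds (ht htu)] with s hs using hd s hs
      rw [this.deriv_eq]
      exact ((hx.hasDerivAt_deriv (ht htu)).add
        (((hv1.differentiable (by simp)) t).hasDerivAt.const_smul ε)).deriv
    rw [hd t (ht htu), hdd]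
  rw [hfun] at h2
  refine Eq.trans ?_ (h1.unique h2)
  refine intervalIntegral.integral_congr_ae ?_
  filter_upwards [ae_mem_Ioo_of_mem_uIoc hL] with t ht htu
  rw [fderiv_lagrangian hβ (hx.norm_deriv (ht htu)) (hx.inner_deriv_deriv_deriv (ht htu))]

/-- The Euler–Lagrange equation, integrated once: the force is constant. -/
theorem exists_force (hx : IsStationaryCurve β L x) (hβ : 0 < β) (hL : 0 < L) :
    ∃ F : E3, ∀ t ∈ Ioo 0 L,
      HasDerivAt (fun s => (Real.sqrt (‖deriv (deriv x) s‖ ^ 2 + β ^ 2))⁻¹ • deriv (deriv x) s)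
        ((Real.sqrt (‖deriv (deriv x) t‖ ^ 2 + β ^ 2)
          - 2 * ‖deriv (deriv x) t‖ ^ 2 / Real.sqrt (‖deriv (deriv x) t‖ ^ 2 + β ^ 2))
            • deriv x t - F) t := by
  set S : ℝ → ℝ := fun t => Real.sqrt (‖deriv (deriv x) t‖ ^ 2 + β ^ 2) with hS
  set g : ℝ → ℝ := fun t => S t - 2 * ‖deriv (deriv x) t‖ ^ 2 / S t with hg
  set w : ℝ → E3 := fun t => (S t)⁻¹ • deriv (deriv x) t with hw
  have hk := hx.contDiffOn_deriv_deriv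
  have hSc : ContDiffOn ℝ ∞ S (Ioo 0 L) :=
    ((hk.norm_sq ℝ).add contDiffOn_const).sqrt fun t _ => by positivity
  have hS0 : ∀ t ∈ Ioo 0 L, S t ≠ 0 := fun t _ => (Real.sqrt_pos.2 (by positivity)).ne'
  have hgc : ContDiffOn ℝ ∞ g (Ioo 0 L) :=
    hSc.sub ((contDiffOn_const.mul (hk.norm_sq ℝ)).div hSc hS0)
  have hwc : ContDiffOn ℝ ∞ w (Ioo 0 L) := (hSc.inv hS0).smul hk
  have hdw : ∀ t ∈ Ioo 0 L, HasDerivAt w (deriv w t) t := fun t ht =>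
    ((hwc.contDiffAt (isOpen_Ioo.mem_nhds ht)).differentiableAt (by simp)).hasDerivAt
  -- The candidate force; the weak equation will show that its derivative vanishes.
  set F : ℝ → E3 := fun t => g t • deriv x t - deriv w t with hF
  have hFc : ContDiffOn ℝ ∞ F (Ioo 0 L) :=
    (hgc.smul hx.contDiffOn_deriv).sub (hwc.deriv_of_isOpen isOpen_Ioo (by simp))
  have hdF : ∀ t ∈ Ioo 0 L, HasDerivAt F (deriv F t) t := fun t ht =>
    ((hFc.contDiffAt (isOpen_Ioo.mem_nhds ht)).differentiableAt (by simp)).hasDerivAt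
  have hF'c : ContinuousOn (deriv F) (Ioo 0 L) :=
    (hFc.deriv_of_isOpen (m := ∞) isOpen_Ioo (by simp)).continuousOn
  have hweak : ∀ c : E3, ∀ t ∈ Ioo 0 L, inner ℝ (deriv F t) c = (0 : ℝ) := by
    intro c
    have hcont : ContinuousOn (fun t => (inner ℝ (deriv F t) c : ℝ)) (Ioo 0 L) :=
      hF'c.inner continuousOn_const
    have hae : ∀ᵐ t ∂(volume : Measure ℝ), t ∈ Ioo 0 L → (inner ℝ (deriv F t) c : ℝ) = 0 := by
      refine isOpen_Ioo.ae_eq_zero_of_integral_contDiff_smul_eq_zero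
        (hcont.locallyIntegrableOn measurableSet_Ioo) ?_
      intro φ hφ hφc hφs
      obtain ⟨a, b, ha, hab, hb, hKab⟩ := exists_Icc_of_isCompact_subset_Ioo hL hφc hφs
      have hIcc : Icc a b ⊆ Ioo 0 L := fun t ht => ⟨ha.trans_le ht.1, ht.2.trans_lt hb⟩
      set v : ℝ → E3 := fun t => φ t • c with hv
      have hvs : ContDiff ℝ ∞ v := hφ.smul contDiff_const
      have hv1 : ContDiff ℝ ∞ (deriv v) := (contDiff_infty_iff_deriv.1 hvs).2
      have hv2 : ContDiff ℝ ∞ (deriv (deriv v)) := (contDiff_infty_iff_deriv.1 hv1).2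
      have hvK : tsupport v ⊆ tsupport φ := closure_mono fun t ht h0 => ht (by simp [hv, h0])
      have hvab : tsupport v ⊆ Ioo a b := hvK.trans hKab
      have hs1 : tsupport (deriv v) ⊆ Ioo a b := tsupport_deriv_subset.trans hvab
      have hs2 : tsupport (deriv (deriv v)) ⊆ Ioo a b := tsupport_deriv_subset.trans hs1
      have hz : ∀ {f : ℝ → E3}, tsupport f ⊆ Ioo a b → ∀ t, t ∉ Ioo a b → f t = 0 :=
        fun hf t ht => image_eq_zero_of_notMem_tsupport fun h => ht (hf h)
      set f₁ : ℝ → ℝ := fun t => g t * inner ℝ (deriv x t) (deriv v t)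
        + inner ℝ (w t) (deriv (deriv v) t) with hf₁
      -- The sum `f₁ + f₂` is the derivative of `w · v' + F · v`, which vanishes at `a` and `b`. As
      -- `f₁` integrates to zero, so does `f₂`.
      set f₂ : ℝ → ℝ := fun t => inner ℝ (deriv F t) (v t) with hf₂
      have hzero : ∫ t in (0 : ℝ)..L, f₁ t = 0 :=
        hx.integral_first_variation hβ hL ha hb hvs hvab
      have hsupp : Function.support f₁ ⊆ Ioo a b := by
        intro t ht
        by_contra h
        exact ht (by simp [hf₁, hz hs1 t h, hz hs2 t h])
      have hsupp2 : Function.support f₂ ⊆ Ioo a b := by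
        intro t ht
        by_contra h
        exact ht (by simp [hf₂, hz hvab t h])
      have hf₁0 : ∫ t in a..b, f₁ t = 0 := by
        rw [intervalIntegral.integral_eq_integral_of_support_subset
          (hsupp.trans Ioo_subset_Ioc_self), ← hzero,
          intervalIntegral.integral_eq_integral_of_support_subset
          (hsupp.trans ((Ioo_subset_Ioo ha.le hb.le).trans Ioo_subset_Ioc_self))]
      have hc₁ : ContinuousOn f₁ (Icc a b) :=
        ((hgc.continuousOn.mono hIcc).mul ((hx.contDiffOn_deriv.continuousOn.mono hIcc).inner
          hv1.continuous.continuousOn)).add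
          ((hwc.continuousOn.mono hIcc).inner hv2.continuous.continuousOn)
      have hc₂ : ContinuousOn f₂ (Icc a b) :=
        (hF'c.mono hIcc).inner hvs.continuous.continuousOn
      have hi₁ : IntervalIntegrable f₁ volume a b := hc₁.intervalIntegrable_of_Icc hab.le
      have hi₂ : IntervalIntegrable f₂ volume a b := hc₂.intervalIntegrable_of_Icc hab.le
      have hftc : ∫ t in a..b, (f₁ t + f₂ t) = 0 := by
        have : ∀ t ∈ uIcc a b, HasDerivAt
            (fun t => (inner ℝ (w t) (deriv v t) : ℝ) + inner ℝ (F t) (v t)) (f₁ t + f₂ t) t := by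
          intro t ht
          rw [uIcc_of_le hab.le] at ht
          have h1 := (hdw t (hIcc ht)).inner ℝ ((hv1.differentiable (by simp)) t).hasDerivAt
          have h2 := (hdF t (hIcc ht)).inner ℝ ((hvs.differentiable (by simp)) t).hasDerivAt
          refine (h1.add h2).congr_deriv ?_
          simp only [hf₁, hf₂, hF, inner_sub_left, inner_smul_left, RCLike.conj_to_real]
          ring
        rw [intervalIntegral.integral_eq_sub_of_hasDerivAt this (hi₁.add hi₂)]
        simp [hz hvab a (by simp), hz hvab b (by simp), hz hs1 a (by simp), hz hs1 b (by simp)]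
      rw [intervalIntegral.integral_add hi₁ hi₂, hf₁0, zero_add,
        intervalIntegral.integral_eq_integral_of_support_subset
          (hsupp2.trans Ioo_subset_Ioc_self)] at hftc
      rw [← hftc]
      refine integral_congr_ae (Filter.Eventually.of_forall fun t => ?_)
      simp [hf₂, hv, inner_smul_right]
    have := Measure.eqOn_open_of_ae_eq ((ae_restrict_iff' measurableSet_Ioo).2 hae) isOpen_Ioo hcont
      continuousOn_const
    exact this
  have hF0 : ∀ t ∈ Ioo 0 L, deriv F t = 0 := fun t ht =>
    inner_self_eq_zero.1 (hweak (deriv F t) t ht)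
  have hmid : L / 2 ∈ Ioo 0 L := ⟨by linarith, by linarith⟩
  refine ⟨F (L / 2), fun t ht => ?_⟩
  have hconst : F t = F (L / 2) :=
    isOpen_Ioo.is_const_of_deriv_eq_zero isPreconnected_Ioo (hFc.differentiableOn (by simp)) hF0 ht hmid
  refine (hdw t ht).congr_deriv ?_
  rw [← hconst]
  exact (sub_sub_cancel (g t • deriv x t) (deriv w t)).symm

end IsStationaryCurve

/-! ### Coplanarity, normals and triple products. -/

theorem coplanar_of_inner_eq_zero {n : E3} (hn : n ≠ 0) {s : Set E3}
    (h : ∀ y ∈ s, inner ℝ n y = (0 : ℝ)) : Coplanar ℝ s := by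
  have : Fact (Module.finrank ℝ E3 = 2 + 1) := ⟨by simp⟩
  rw [coplanar_iff_finrank_le_two]
  refine (Submodule.finrank_mono (Submodule.span_le.2 ?_)).trans_eq
    (Submodule.finrank_orthogonal_span_singleton (𝕜 := ℝ) (n := 2) hn)
  rintro _ ⟨y, hy, z, hz, rfl⟩
  rw [SetLike.mem_coe, Submodule.mem_orthogonal_singleton_iff_inner_right]
  simp [inner_sub_right, h y hy, h z hz]

/-- Expansion of `n` in the dual basis, cleared of denominators. A nonzero `n` orthogonal to all
three vectors forces their triple product to vanish. -/
theorem triple_smul_eq (n u v w : E3) : triple u v w • n = (inner ℝ n u : ℝ) • cross v w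
    + (inner ℝ n v : ℝ) • cross w u + (inner ℝ n w : ℝ) • cross u v := by
  apply E3.ext_coord <;>
    simp [inner_E3, triple_eq, cross_apply_zero, cross_apply_one, cross_apply_two] <;> ring

theorem triple_eq_zero_of_coplanar {u v w : E3} (h : Coplanar ℝ {0, u, v, w}) :
    triple u v w = 0 := by
  rw [coplanar_iff_finrank_le_two] at h
  set V := vectorSpan ℝ ({0, u, v, w} : Set E3) with hV
  have hmem : ∀ y ∈ ({0, u, v, w} : Set E3), y ∈ V := by
    intro y hy
    have := vsub_mem_vectorSpan ℝ hy (show (0 : E3) ∈ ({0, u, v, w} : Set E3) by simp)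
    simpa using this
  have hdim := V.finrank_add_finrank_orthogonal
  have h3 : Module.finrank ℝ E3 = 3 := by simp
  have hpos : 0 < Module.finrank ℝ Vᗮ := by omega
  have : Nontrivial Vᗮ := Module.finrank_pos_iff.1 hpos
  obtain ⟨⟨n, hnV⟩, hn⟩ := exists_ne (0 : Vᗮ)
  have hn0 : n ≠ 0 := fun h => hn (Subtype.ext h)
  have hin : ∀ y ∈ ({0, u, v, w} : Set E3), (inner ℝ n y : ℝ) = 0 := fun y hy =>
    Submodule.inner_left_of_mem_orthogonal (hmem y hy) hnV
  have := triple_smul_eq n u v w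
  rw [hin u (by simp), hin v (by simp), hin w (by simp)] at this
  simpa [hn0] using this

/-- As the curve starts at the origin, its plane gives a linear subspace containing it. This
subspace is closed, so it also contains every one-sided or two-sided derivative. -/
theorem coplanar_of_coplanar_image {L : ℝ} (hL : 0 < L) {x : ℝ → E3} (x0 : x 0 = 0)
    (h : Coplanar ℝ (x '' Icc 0 L)) {s : ℝ} (hs : s ∈ Icc 0 L) :
    Coplanar ℝ {0, derivWithin x (Icc 0 L) 0, x s, derivWithin x (Icc 0 L) s} := by
  rw [coplanar_iff_finrank_le_two] at *
  refine le_trans (Submodule.finrank_mono (Submodule.span_le.2 ?_)) h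
  set V := vectorSpan ℝ (x '' Icc 0 L)
  have hx : ∀ t ∈ Icc 0 L, x t ∈ V := by
    intro t ht
    have := vsub_mem_vectorSpan ℝ (mem_image_of_mem x ht)
      (mem_image_of_mem x (show (0 : ℝ) ∈ Icc 0 L from ⟨le_rfl, hL.le⟩))
    simpa [x0] using this
  have hd : ∀ t, derivWithin x (Icc 0 L) t ∈ V := by
    intro t
    have h1 := range_derivWithin_subset_closure_span_image (𝕜 := ℝ) x (s := Icc 0 L)
      (t := Icc 0 L) (by rw [inter_self]; exact subset_closure) (mem_range_self t)
    have h2 : (Submodule.span ℝ (x '' Icc 0 L) : Set E3) ⊆ V := by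
      refine Submodule.span_le.2 ?_
      rintro _ ⟨t, ht, rfl⟩
      exact hx t ht
    exact closure_minimal h2 V.closed_of_finiteDimensional h1
  have hall : ∀ y ∈ ({0, derivWithin x (Icc 0 L) 0, x s, derivWithin x (Icc 0 L) s} : Set E3),
      y ∈ V := by
    rintro y (rfl | rfl | rfl | rfl)
    exacts [V.zero_mem, hd 0, hx s hs, hd s]
  rintro _ ⟨y, hy, z, hz, rfl⟩
  exact V.sub_mem (hall y hy) (hall z hz)

/-! ### Force and torque along a stationary curve. -/

theorem cross_self_smul (c : ℝ) (u : E3) : cross u (c • u) = 0 := by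
  apply E3.ext_coord <;> simp [cross_apply_zero, cross_apply_one, cross_apply_two] <;> ring

theorem cross_cross_left (u v : E3) :
    cross (cross u v) u = (inner ℝ u u : ℝ) • v - (inner ℝ u v : ℝ) • u := by
  apply E3.ext_coord <;>
    simp only [PiLp.sub_apply, PiLp.smul_apply, smul_eq_mul, inner_E3, cross_apply_zero, cross_apply_one,
      cross_apply_two] <;> ring

theorem inner_cross_self_right (u v : E3) : inner ℝ (cross u v) u = (0 : ℝ) := by
  simp only [inner_E3, cross_apply_zero, cross_apply_one, cross_apply_two]
  ring

namespace IsStationaryCurve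

variable {β L : ℝ} {x : ℝ → E3}

/-- Conservation of the force and of the torque. -/
theorem exists_force_torque (hx : IsStationaryCurve β L x) (hβ : 0 < β) (hL : 0 < L) :
    ∃ F M : E3, ∃ S : ℝ → ℝ, ∃ g : ℝ → ℝ, ∃ w : ℝ → E3,
      (∀ t, S t = Real.sqrt (‖deriv (deriv x) t‖ ^ 2 + β ^ 2)) ∧
      (∀ t, w t = (S t)⁻¹ • deriv (deriv x) t) ∧
      (∀ t ∈ Ioo 0 L, HasDerivAt w (g t • deriv x t - F) t) ∧
      (∀ t ∈ Ioo 0 L, inner ℝ F (deriv x t) = β ^ 2 / S t) ∧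
      (∀ t ∈ Ioo 0 L, M - cross (x t) F = cross (deriv x t) (w t)) := by
  obtain ⟨F, hF⟩ := hx.exists_force hβ hL
  set S : ℝ → ℝ := fun t => Real.sqrt (‖deriv (deriv x) t‖ ^ 2 + β ^ 2) with hS
  set g : ℝ → ℝ := fun t => S t - 2 * ‖deriv (deriv x) t‖ ^ 2 / S t with hg
  set w : ℝ → E3 := fun t => (S t)⁻¹ • deriv (deriv x) t with hw
  have hw' : ∀ t ∈ Ioo 0 L, HasDerivAt w (g t • deriv x t - F) t := hF
  have hSpos : ∀ t, 0 < S t := fun t => Real.sqrt_pos.2 (by positivity)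
  have hSsq : ∀ t, S t ^ 2 = ‖deriv (deriv x) t‖ ^ 2 + β ^ 2 := fun t =>
    Real.sq_sqrt (by positivity)
  have hwT : ∀ t ∈ Ioo 0 L, inner ℝ (w t) (deriv x t) = (0 : ℝ) := by
    intro t ht
    rw [hw, inner_smul_left, real_inner_comm, hx.inner_deriv_deriv_deriv ht, mul_zero]
  -- Differentiating `w · T = 0` gives `F · T = g + κ² / S = (S² - κ²) / S`.
  have hFT : ∀ t ∈ Ioo 0 L, inner ℝ F (deriv x t) = β ^ 2 / S t := by
    intro t ht
    have h1 := (hw' t ht).inner ℝ (hx.hasDerivAt_deriv ht)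
    have h2 : (fun s => (inner ℝ (w s) (deriv x s) : ℝ)) =ᶠ[nhds t] fun _ => 0 := by
      filter_upwards [isOpen_Ioo.mem_nhds ht] with s hs using hwT s hs
    have h3 := h1.unique ((hasDerivAt_const t (0 : ℝ)).congr_of_eventuallyEq h2)
    have h4 : inner ℝ (w t) (deriv (deriv x) t) = ‖deriv (deriv x) t‖ ^ 2 / S t := by
      rw [hw, inner_smul_left, real_inner_self_eq_norm_sq, RCLike.conj_to_real]
      ring
    rw [h4, inner_sub_left, inner_smul_left, real_inner_self_eq_norm_sq, hx.norm_deriv ht,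
      RCLike.conj_to_real] at h3
    have h5 : inner ℝ F (deriv x t) = g t + ‖deriv (deriv x) t‖ ^ 2 / S t := by linarith
    have h6 := (hSpos t).ne'
    rw [h5, hg]
    field_simp
    linarith [hSsq t]
  set N : ℝ → E3 := fun t => cross (x t) F + cross (deriv x t) (w t) with hN
  -- The terms `T × F` cancel, and `T' × w` vanishes because `w` is a multiple of `T'`.
  have hN' : ∀ t ∈ Ioo 0 L, HasDerivAt N 0 t := by
    intro t ht
    have h1 := ((hx.hasDerivAt ht).cross (hasDerivAt_const t F)).add
      ((hx.hasDerivAt_deriv ht).cross (hw' t ht))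
    refine h1.congr_deriv ?_
    rw [hw, cross_self_smul]
    apply E3.ext_coord <;> simp [cross_apply_zero, cross_apply_one, cross_apply_two] <;> ring
  have hmid : L / 2 ∈ Ioo 0 L := ⟨by linarith, by linarith⟩
  refine ⟨F, N (L / 2), S, g, w, fun t => rfl, fun t => rfl, hw', hFT, fun t ht => ?_⟩
  have : N t = N (L / 2) := isOpen_Ioo.is_const_of_deriv_eq_zero isPreconnected_Ioo
    (fun s hs => (hN' s hs).differentiableAt.differentiableWithinAt)
    (fun s hs => (hN' s hs).deriv) ht hmid
  rw [← this]
  simp [hN]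

theorem continuousOn_derivWithin (hx : IsStationaryCurve β L x) (hL : 0 < L) :
    ContinuousOn (derivWithin x (Icc 0 L)) (Icc 0 L) :=
  hx.contDiffOn_Icc.continuousOn_derivWithin (uniqueDiffOn_Icc hL) le_rfl

theorem triple_ne_zero (hx : IsStationaryCurve β L x) (hL : 0 < L) {F M : E3} {S : ℝ → ℝ}
    {w : ℝ → E3} (hS : ∀ t, 0 < S t) (hw : ∀ t, w t = (S t)⁻¹ • deriv (deriv x) t)
    (hFT : ∀ t ∈ Ioo 0 L, 0 ≤ (inner ℝ F (deriv x t) : ℝ))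
    (hM : ∀ t ∈ Ioo 0 L, M - cross (x t) F = cross (deriv x t) (w t))
    (hMF : (inner ℝ M F : ℝ) ≠ 0) {s : ℝ} (hs : s ∈ Ioc 0 L) :
    triple (x s) (derivWithin x (Icc 0 L) s) (derivWithin x (Icc 0 L) 0) ≠ 0 := by
  have hcl : Icc 0 L ⊆ closure (Ioo 0 L) := by rw [closure_Ioo hL.ne]
  have hTc := hx.continuousOn_derivWithin hL
  have hxc : ContinuousOn x (Icc 0 L) := hx.contDiffOn_Icc.continuousOn
  have hpc : ContinuousOn (fun t => M - cross (x t) F) (Icc 0 L) :=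
    continuousOn_const.sub (hxc.cross continuousOn_const)
  have hdw : ∀ t ∈ Ioo 0 L, derivWithin x (Icc 0 L) t = deriv x t :=
    fun t ht => derivWithin_eq_deriv ht
  refine triple_ne_zero_of_inner_ne_zero (S := S) hL hxc hTc ?_ ?_ (fun t _ => hS t) hx.start ?_
    ?_ ?_ hMF s hs
  · intro t ht
    rw [hdw t ht]
    exact hx.hasDerivAt ht
  · intro t ht
    have h1 : HasDerivAt (derivWithin x (Icc 0 L)) (deriv (deriv x) t) t := by
      refine (hx.hasDerivAt_deriv ht).congr_of_eventuallyEq ?_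
      filter_upwards [isOpen_Ioo.mem_nhds ht] with s hs using hdw s hs
    -- Here `(T × w) × T = w`, since `T` is a unit vector orthogonal to `w`, and `S w = T'`.
    refine h1.congr_deriv ?_
    rw [hM t ht, hdw t ht, cross_cross_left, hw, inner_smul_right, hx.inner_deriv_deriv_deriv ht,
      real_inner_self_eq_norm_sq, hx.norm_deriv ht, mul_zero, zero_smul, sub_zero, one_pow,
      one_smul, smul_inv_smul₀ (hS t).ne']
  · intro t ht
    rw [real_inner_self_eq_norm_sq, hx.arcLength t ht, one_pow]
  · have : EqOn (fun t => (inner ℝ (M - cross (x t) F) (derivWithin x (Icc 0 L) t) : ℝ))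
        (fun _ => 0) (Ioo 0 L) := by
      intro t ht
      simp only [hdw t ht, hM t ht, inner_cross_self_right]
    exact this.of_subset_closure (hpc.inner hTc) continuousOn_const Ioo_subset_Icc_self hcl
  · have hc : ContinuousOn (fun t => (inner ℝ F (derivWithin x (Icc 0 L) t) : ℝ)) (Icc 0 L) :=
      continuousOn_const.inner hTc
    -- Nonnegativity is phrased as equality with the absolute value, so that it extends to the end
    -- points by continuity.
    have : EqOn (fun t => (inner ℝ F (derivWithin x (Icc 0 L) t) : ℝ))
        (fun t => |(inner ℝ F (derivWithin x (Icc 0 L) t) : ℝ)|) (Ioo 0 L) := by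
      intro t ht
      simp only [hdw t ht, abs_of_nonneg (hFT t ht)]
    intro t ht
    have := this.of_subset_closure hc hc.abs Ioo_subset_Icc_self hcl ht
    simp only at this
    rw [this]
    exact abs_nonneg _

end IsStationaryCurve

/-! ### The moving frame and planarity for `W = 0`. -/

/-- The columns of a matrix, as vectors of `E3`. -/
noncomputable def column (A : Matrix (Fin 3) (Fin 3) ℝ) (j : Fin 3) : E3 :=
  WithLp.toLp 2 fun i => A i j

theorem column_apply (A : Matrix (Fin 3) (Fin 3) ℝ) (j i : Fin 3) : column A j i = A i j := rfl

theorem inner_column {A : Matrix (Fin 3) (Fin 3) ℝ}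
    (hA : A ∈ Matrix.specialOrthogonalGroup (Fin 3) ℝ) (i j : Fin 3) :
    inner ℝ (column A i) (column A j) = if i = j then (1 : ℝ) else 0 := by
  have h : Aᵀ * A = 1 := (Matrix.mem_orthogonalGroup_iff' _ _).1
    (Matrix.mem_specialOrthogonalGroup_iff.1 hA).1
  have h2 := congrFun (congrFun h i) j
  rw [Matrix.mul_apply, Fin.sum_univ_three, Matrix.one_apply] at h2
  rw [inner_E3, ← h2]
  rfl

/-- Read entry by entry, this yields the cross products of the columns, orientation included. -/
theorem adjugate_of_mem_specialOrthogonalGroup {A : Matrix (Fin 3) (Fin 3) ℝ}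
    (hA : A ∈ Matrix.specialOrthogonalGroup (Fin 3) ℝ) : A.adjugate = Aᵀ := by
  obtain ⟨h1, h2⟩ := Matrix.mem_specialOrthogonalGroup_iff.1 hA
  have h : A * Aᵀ = 1 := (Matrix.mem_orthogonalGroup_iff _ _).1 h1
  calc A.adjugate = A.adjugate * (A * Aᵀ) := by rw [h, mul_one]
    _ = Aᵀ := by rw [← mul_assoc, Matrix.adjugate_mul, h2, one_smul, one_mul]

theorem cross_column_two_zero {A : Matrix (Fin 3) (Fin 3) ℝ}
    (hA : A ∈ Matrix.specialOrthogonalGroup (Fin 3) ℝ) :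
    cross (column A 2) (column A 0) = column A 1 := by
  have h := adjugate_of_mem_specialOrthogonalGroup hA
  rw [Matrix.adjugate_fin_three] at h
  have h0 := congrFun (congrFun h 1) 0
  have h1 := congrFun (congrFun h 1) 1
  have h2 := congrFun (congrFun h 1) 2
  simp at h0 h1 h2
  apply E3.ext_coord <;>
    simp only [cross_apply_zero, cross_apply_one, cross_apply_two, column_apply] <;> linarith

theorem cross_column_two_one {A : Matrix (Fin 3) (Fin 3) ℝ}
    (hA : A ∈ Matrix.specialOrthogonalGroup (Fin 3) ℝ) :
    cross (column A 2) (column A 1) = -column A 0 := by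
  have h := adjugate_of_mem_specialOrthogonalGroup hA
  rw [Matrix.adjugate_fin_three] at h
  have h0 := congrFun (congrFun h 0) 0
  have h1 := congrFun (congrFun h 0) 1
  have h2 := congrFun (congrFun h 0) 2
  simp at h0 h1 h2
  apply E3.ext_coord <;>
    simp only [cross_apply_zero, cross_apply_one, cross_apply_two, column_apply,
      PiLp.neg_apply] <;> linarith

theorem cross_smul_add_smul (a b : ℝ) (u v w : E3) :
    cross u (a • v + b • w) = a • cross u v + b • cross u w := by
  apply E3.ext_coord <;>
    simp [cross_apply_zero, cross_apply_one, cross_apply_two] <;> ring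

/-- A solution of `v' = -f`, `f' = -β ^ 2 v` which vanishes at one point vanishes identically. -/
theorem eq_zero_of_hyperbolic_system {β L s₀ : ℝ} (hβ : 0 < β) {v f : ℝ → ℝ}
    (hv : ∀ t ∈ Ioo 0 L, HasDerivAt v (-f t) t)
    (hf : ∀ t ∈ Ioo 0 L, HasDerivAt f (-(β ^ 2 * v t)) t)
    (hs₀ : s₀ ∈ Ioo 0 L) (v0 : v s₀ = 0) (f0 : f s₀ = 0) : ∀ t ∈ Ioo 0 L, v t = 0 := by
  -- For `c = ±β` the combination `c v + f` is an eigenmode, so `exp (c s) (c v + f)` is constant.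
  have key : ∀ c : ℝ, c ^ 2 = β ^ 2 → ∀ t ∈ Ioo 0 L, c * v t + f t = 0 := by
    intro c hc t ht
    have hd : ∀ t ∈ Ioo 0 L,
        HasDerivAt (fun s => Real.exp (c * s) * (c * v s + f s)) 0 t := by
      intro t ht
      have h1 : HasDerivAt (fun s => Real.exp (c * s)) (Real.exp (c * t) * c) t := by
        simpa using ((hasDerivAt_id t).const_mul c).exp
      refine (h1.mul (((hv t ht).const_mul c).add (hf t ht))).congr_deriv ?_
      rw [← hc]
      simp only [Pi.add_apply]
      ring
    have := isOpen_Ioo.is_const_of_deriv_eq_zero isPreconnected_Ioo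
      (fun s hs => (hd s hs).differentiableAt.differentiableWithinAt)
      (fun s hs => (hd s hs).deriv) ht hs₀
    simpa [v0, f0, (Real.exp_pos _).ne'] using this
  intro t ht
  have h1 := key β rfl t ht
  have h2 := key (-β) (by ring) t ht
  have : 2 * β * v t = 0 := by linarith
  simpa [hβ.ne'] using this

namespace IsHorizontalLift

variable {L : ℝ} {x : ℝ → E3} {R : ℝ → Matrix (Fin 3) (Fin 3) ℝ} {κ₁ κ₂ : ℝ → ℝ}

theorem derivWithin_eq (h : IsHorizontalLift L x R κ₁ κ₂) (hL : 0 < L) {s : ℝ}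
    (hs : s ∈ Icc 0 L) : derivWithin x (Icc 0 L) s = column (R s) 2 := by
  rw [(h.tangent s hs).derivWithin (uniqueDiffOn_Icc hL s hs)]
  ext i
  simp [column, eZ, Matrix.mulVec, dotProduct, Fin.sum_univ_three]

theorem hasDerivAt_column_zero (h : IsHorizontalLift L x R κ₁ κ₂) {s : ℝ} (hs : s ∈ Ioo 0 L) :
    HasDerivAt (fun t => column (R t) 0) (-κ₁ s • column (R s) 2) s := by
  rw [hasDerivAt_E3_iff]
  intro i
  refine (h.rotation_deriv s hs i 0).congr_deriv ?_
  simp [Matrix.mul_apply, Fin.sum_univ_three, column_apply, mul_comm]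

theorem hasDerivAt_column_one (h : IsHorizontalLift L x R κ₁ κ₂) {s : ℝ} (hs : s ∈ Ioo 0 L) :
    HasDerivAt (fun t => column (R t) 1) (-κ₂ s • column (R s) 2) s := by
  rw [hasDerivAt_E3_iff]
  intro i
  refine (h.rotation_deriv s hs i 1).congr_deriv ?_
  simp [Matrix.mul_apply, Fin.sum_univ_three, column_apply, mul_comm]

theorem hasDerivAt_column_two (h : IsHorizontalLift L x R κ₁ κ₂) {s : ℝ} (hs : s ∈ Ioo 0 L) :
    HasDerivAt (fun t => column (R t) 2)
      (κ₁ s • column (R s) 0 + κ₂ s • column (R s) 1) s := by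
  rw [hasDerivAt_E3_iff]
  intro i
  refine (h.rotation_deriv s hs i 2).congr_deriv ?_
  simp [Matrix.mul_apply, Fin.sum_univ_three, column_apply, mul_comm]

theorem deriv_eq (h : IsHorizontalLift L x R κ₁ κ₂) (hL : 0 < L) {s : ℝ} (hs : s ∈ Ioo 0 L) :
    deriv x s = column (R s) 2 := by
  rw [← h.derivWithin_eq hL (Ioo_subset_Icc_self hs), derivWithin_of_mem_nhds
    (Icc_mem_nhds hs.1 hs.2)]

theorem deriv_deriv_eq (h : IsHorizontalLift L x R κ₁ κ₂) (hL : 0 < L) {s : ℝ}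
    (hs : s ∈ Ioo 0 L) :
    deriv (deriv x) s = κ₁ s • column (R s) 0 + κ₂ s • column (R s) 1 := by
  have : deriv x =ᶠ[nhds s] fun t => column (R t) 2 := by
    filter_upwards [isOpen_Ioo.mem_nhds hs] with t ht using h.deriv_eq hL ht
  rw [this.deriv_eq, (h.hasDerivAt_column_two hs).deriv]

theorem inner_column (h : IsHorizontalLift L x R κ₁ κ₂) {s : ℝ} (hs : s ∈ Ioo 0 L)
    (i j : Fin 3) : inner ℝ (column (R s) i) (column (R s) j) = if i = j then (1 : ℝ) else 0 :=
  _root_.inner_column (h.rotation s (Ioo_subset_Icc_self hs)) i j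

theorem norm_deriv_deriv_sq (h : IsHorizontalLift L x R κ₁ κ₂) (hL : 0 < L) {s : ℝ}
    (hs : s ∈ Ioo 0 L) : ‖deriv (deriv x) s‖ ^ 2 = κ₁ s ^ 2 + κ₂ s ^ 2 := by
  rw [← real_inner_self_eq_norm_sq, h.deriv_deriv_eq hL hs]
  simp only [inner_add_left, inner_add_right, inner_smul_left, inner_smul_right,
    h.inner_column hs]
  simp
  ring

/-- If the force is orthogonal to the torque then the curve lies in a plane. -/
theorem exists_normal (h : IsHorizontalLift L x R κ₁ κ₂) {β : ℝ}
    (hx : IsStationaryCurve β L x) (hβ : 0 < β) (hL : 0 < L) {F : E3} {S g : ℝ → ℝ} {w : ℝ → E3}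
    (hS : ∀ t, 0 < S t) (hw : ∀ t, w t = (S t)⁻¹ • deriv (deriv x) t)
    (hw' : ∀ t ∈ Ioo 0 L, HasDerivAt w (g t • deriv x t - F) t)
    (hFT : ∀ t ∈ Ioo 0 L, inner ℝ F (deriv x t) = β ^ 2 / S t)
    {s₀ : ℝ} (hs₀ : s₀ ∈ Ioo 0 L)
    (hW : inner ℝ (w s₀) (column (R s₀) 0) * inner ℝ F (column (R s₀) 1)
      = (inner ℝ (w s₀) (column (R s₀) 1) * inner ℝ F (column (R s₀) 0) : ℝ)) :
    ∃ n : E3, n ≠ 0 ∧ ∀ t ∈ Icc 0 L, inner ℝ n (x t) = (0 : ℝ) := by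
  -- By `hW` the normal components of `w` and `F` at `s₀` are linearly dependent, so one nonzero
  -- pair annihilates both.
  obtain ⟨b₁, b₂, hb, hbw, hbF⟩ : ∃ b₁ b₂ : ℝ, b₁ ^ 2 + b₂ ^ 2 ≠ 0 ∧
      b₁ * inner ℝ (w s₀) (column (R s₀) 0) + b₂ * inner ℝ (w s₀) (column (R s₀) 1) = 0 ∧
      b₁ * inner ℝ F (column (R s₀) 0) + b₂ * inner ℝ F (column (R s₀) 1) = 0 := by
    generalize (inner ℝ (w s₀) (column (R s₀) 0) : ℝ) = p at *
    generalize (inner ℝ (w s₀) (column (R s₀) 1) : ℝ) = q at *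
    generalize (inner ℝ F (column (R s₀) 0) : ℝ) = r at *
    generalize (inner ℝ F (column (R s₀) 1) : ℝ) = u at *
    have hsq : ∀ a b : ℝ, a ^ 2 + b ^ 2 = 0 → a = 0 ∧ b = 0 := fun a b hab =>
      ⟨by nlinarith [sq_nonneg a, sq_nonneg b], by nlinarith [sq_nonneg a, sq_nonneg b]⟩
    by_cases h1 : p ^ 2 + q ^ 2 = 0
    · obtain ⟨rfl, rfl⟩ := hsq p q h1
      by_cases h2 : r ^ 2 + u ^ 2 = 0
      · obtain ⟨rfl, rfl⟩ := hsq r u h2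
        exact ⟨1, 0, by norm_num, by ring, by ring⟩
      · exact ⟨u, -r, by rwa [neg_sq, add_comm], by ring, by ring⟩
    · exact ⟨q, -p, by rwa [neg_sq, add_comm], by ring, by linarith⟩
  set n : ℝ → E3 := fun t => b₁ • column (R t) 0 + b₂ • column (R t) 1 with hn
  have hn' : ∀ t ∈ Ioo 0 L, HasDerivAt n (-(b₁ * κ₁ t + b₂ * κ₂ t) • deriv x t) t := by
    intro t ht
    refine (((h.hasDerivAt_column_zero ht).const_smul b₁).add
      ((h.hasDerivAt_column_one ht).const_smul b₂)).congr_deriv ?_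
    rw [h.deriv_eq hL ht]
    module
  have hnT : ∀ t ∈ Ioo 0 L, inner ℝ (n t) (deriv x t) = (0 : ℝ) := by
    intro t ht
    rw [h.deriv_eq hL ht]
    simp [hn, inner_add_left, inner_smul_left, h.inner_column ht]
  have hwT : ∀ t ∈ Ioo 0 L, inner ℝ (w t) (deriv x t) = (0 : ℝ) := by
    intro t ht
    rw [hw, inner_smul_left, real_inner_comm, hx.inner_deriv_deriv_deriv ht, mul_zero]
  have hSv : ∀ t ∈ Ioo 0 L, b₁ * κ₁ t + b₂ * κ₂ t = S t * inner ℝ (w t) (n t) := by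
    intro t ht
    rw [hw, h.deriv_deriv_eq hL ht, inner_smul_left]
    simp only [hn, inner_add_left, inner_add_right, inner_smul_left, inner_smul_right,
      h.inner_column ht]
    have := (hS t).ne'
    simp
    field_simp
  -- With `n' = -S (w · n) T`, the factor `S` cancels against `F · T = β² / S`: `(w · n)' = -F · n`
  -- and `(F · n)' = -β² (w · n)`.
  have hv0 : ∀ t ∈ Ioo 0 L, (inner ℝ (w t) (n t) : ℝ) = 0 := by
    refine eq_zero_of_hyperbolic_system (f := fun t => inner ℝ F (n t)) hβ ?_ ?_ hs₀ ?_ ?_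
    · intro t ht
      refine ((hw' t ht).inner ℝ (hn' t ht)).congr_deriv ?_
      rw [inner_smul_right, hwT t ht, inner_sub_left, inner_smul_left, real_inner_comm,
        hnT t ht]
      ring
    · intro t ht
      refine ((hasDerivAt_const t F).inner ℝ (hn' t ht)).congr_deriv ?_
      have := (hS t).ne'
      rw [inner_smul_right, hFT t ht, hSv t ht, inner_zero_left]
      field_simp
      ring
    · simpa [hn, inner_add_right, inner_smul_right] using hbw
    · simpa [hn, inner_add_right, inner_smul_right] using hbF
  have hnc : ∀ t ∈ Ioo 0 L, n t = n s₀ := fun t ht =>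
    isOpen_Ioo.is_const_of_deriv_eq_zero isPreconnected_Ioo
      (fun s hs => (hn' s hs).differentiableAt.differentiableWithinAt)
      (fun s hs => by rw [(hn' s hs).deriv, hSv s hs, hv0 s hs]; simp) ht hs₀
  refine ⟨n s₀, fun h0 => hb ?_, ?_⟩
  · have : (inner ℝ (n s₀) (n s₀) : ℝ) = b₁ ^ 2 + b₂ ^ 2 := by
      simp only [hn, inner_add_left, inner_add_right, inner_smul_left, inner_smul_right,
        h.inner_column hs₀]
      simp
      ring
    rw [← this, h0, inner_zero_left]
  · have hd : ∀ t ∈ Ioo 0 L, HasDerivAt (fun s => (inner ℝ (n s₀) (x s) : ℝ)) 0 t := by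
      intro t ht
      refine ((hasDerivAt_const t (n s₀)).inner ℝ (hx.hasDerivAt ht)).congr_deriv ?_
      rw [← hnc t ht, hnT t ht, inner_zero_left, add_zero]
    have hc : ContinuousOn (fun s => (inner ℝ (n s₀) (x s) : ℝ)) (Icc 0 L) :=
      continuousOn_const.inner hx.contDiffOn_Icc.continuousOn
    have hcl : Icc 0 L ⊆ closure (Ioo 0 L) := by rw [closure_Ioo hL.ne]
    have hconst : EqOn (fun s => (inner ℝ (n s₀) (x s) : ℝ))
        (fun _ => inner ℝ (n s₀) (x s₀)) (Icc 0 L) := by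
      refine EqOn.of_subset_closure (s := Ioo 0 L) ?_ hc continuousOn_const Ioo_subset_Icc_self hcl
      intro t ht
      exact isOpen_Ioo.is_const_of_deriv_eq_zero isPreconnected_Ioo
        (fun s hs => (hd s hs).differentiableAt.differentiableWithinAt)
        (fun s hs => (hd s hs).deriv) ht hs₀
    intro t ht
    have h1 := hconst ht
    have h2 := hconst (show (0 : ℝ) ∈ Icc 0 L from ⟨le_rfl, hL.le⟩)
    simp only [hx.start, inner_zero_right] at h1 h2
    rw [h1, ← h2]

end IsHorizontalLift

/-! ### The Wronskian and the equivalence. -/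

theorem mainTheorem3 (β L : ℝ) (hβ : 0 < β) (hL : 0 < L)
    (x : ℝ → E3) (R : ℝ → Matrix (Fin 3) (Fin 3) ℝ) (κ₁ κ₂ : ℝ → ℝ)
    (hγ : IsCusplessGeodesic β L x R κ₁ κ₂) :
    ∃ W : ℝ, (∀ t ∈ Ioo 0 L, wronskian β κ₁ κ₂ t = W) ∧
      ∀ s ∈ Ioc 0 L, List.TFAE
        [Coplanar ℝ {0, eZ, x s, derivWithin x (Icc 0 L) s},
          inner ℝ eZ (cross (x s) (derivWithin x (Icc 0 L) s)) = 0,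
          Coplanar ℝ (x '' Icc 0 L),
          W = 0] := by
  obtain ⟨hx, h⟩ := hγ
  obtain ⟨F, M, S, g, w, hS, hw, hw', hFT, hM⟩ := hx.exists_force_torque hβ hL
  have hSpos : ∀ t, 0 < S t := fun t => by
    rw [hS]
    exact Real.sqrt_pos.2 (by positivity)
  have hSκ : ∀ t ∈ Ioo 0 L, S t = Real.sqrt (κ₁ t ^ 2 + κ₂ t ^ 2 + β ^ 2) := fun t ht => by
    rw [hS, h.norm_deriv_deriv_sq hL ht]
  have hww : ∀ t ∈ Ioo 0 L,
      w t = w₁ β κ₁ κ₂ t • column (R t) 0 + w₂ β κ₁ κ₂ t • column (R t) 1 := by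
    intro t ht
    rw [hw, h.deriv_deriv_eq hL ht, w₁, w₂, ← hSκ t ht]
    module
  have hw1 : ∀ t ∈ Ioo 0 L, inner ℝ (w t) (column (R t) 0) = w₁ β κ₁ κ₂ t := by
    intro t ht
    simp only [hww t ht, inner_add_left, inner_smul_left, h.inner_column ht]
    simp
  have hw2 : ∀ t ∈ Ioo 0 L, inner ℝ (w t) (column (R t) 1) = w₂ β κ₁ κ₂ t := by
    intro t ht
    simp only [hww t ht, inner_add_left, inner_smul_left, h.inner_column ht]
    simp
  have hwT : ∀ t ∈ Ioo 0 L, inner ℝ (w t) (column (R t) 2) = (0 : ℝ) := by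
    intro t ht
    simp only [hww t ht, inner_add_left, inner_smul_left, h.inner_column ht]
    simp
  -- The frame vector turns only along `T`, which is orthogonal to `w`, so only `w' = g T - F`
  -- contributes.
  have hd1 : ∀ t ∈ Ioo 0 L, deriv (w₁ β κ₁ κ₂) t = -inner ℝ F (column (R t) 0) := by
    intro t ht
    have : w₁ β κ₁ κ₂ =ᶠ[nhds t] fun s => inner ℝ (w s) (column (R s) 0) := by
      filter_upwards [isOpen_Ioo.mem_nhds ht] with s hs using (hw1 s hs).symm
    rw [this.deriv_eq, ((hw' t ht).inner ℝ (h.hasDerivAt_column_zero ht)).deriv,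
      inner_smul_right, hwT t ht, inner_sub_left, inner_smul_left, h.deriv_eq hL ht,
      h.inner_column ht]
    simp
  have hd2 : ∀ t ∈ Ioo 0 L, deriv (w₂ β κ₁ κ₂) t = -inner ℝ F (column (R t) 1) := by
    intro t ht
    have : w₂ β κ₁ κ₂ =ᶠ[nhds t] fun s => inner ℝ (w s) (column (R s) 1) := by
      filter_upwards [isOpen_Ioo.mem_nhds ht] with s hs using (hw2 s hs).symm
    rw [this.deriv_eq, ((hw' t ht).inner ℝ (h.hasDerivAt_column_one ht)).deriv,
      inner_smul_right, hwT t ht, inner_sub_left, inner_smul_left, h.deriv_eq hL ht,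
      h.inner_column ht]
    simp
  -- Since `x × F ⊥ F`, `M · F = (T × w) · F`; the frame's cross products turn this into `w₂ w₁' -
  -- w₁ w₂'`.
  have hwr : ∀ t ∈ Ioo 0 L, wronskian β κ₁ κ₂ t = -inner ℝ M F := by
    intro t ht
    have hR := h.rotation t (Ioo_subset_Icc_self ht)
    have h1 : (inner ℝ M F : ℝ) = inner ℝ (M - cross (x t) F) F := by
      simp only [inner_sub_left, inner_E3, cross_apply_zero, cross_apply_one, cross_apply_two]
      ring
    rw [h1, hM t ht, h.deriv_eq hL ht, hww t ht, cross_smul_add_smul, cross_column_two_zero hR,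
      cross_column_two_one hR, wronskian, hd1 t ht, hd2 t ht, inner_add_left, inner_smul_left,
      inner_smul_left, inner_neg_left, real_inner_comm F, real_inner_comm F]
    simp
    ring
  have hT0 : derivWithin x (Icc 0 L) 0 = eZ := hx.start_direction
  refine ⟨-inner ℝ M F, hwr, fun s hs => ?_⟩
  have hs' : s ∈ Icc 0 L := Ioc_subset_Icc_self hs
  tfae_have 1 → 2 := triple_eq_zero_of_coplanar
  tfae_have 2 → 4 := by
    intro h2
    by_contra hW
    refine hx.triple_ne_zero hL hSpos hw (fun t ht => ?_) hM (fun h0 => hW (by rw [h0, neg_zero]))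
      hs ?_
    · rw [hFT t ht]
      exact div_nonneg (sq_nonneg β) (hSpos t).le
    · rw [hT0]
      refine Eq.trans ?_ h2
      change triple _ _ _ = triple _ _ _
      simp only [triple_eq]
      ring
  tfae_have 4 → 3 := by
    intro hW
    -- Any interior point would do, the Wronskian being constant.
    have hmid : L / 2 ∈ Ioo 0 L := ⟨by linarith, by linarith⟩
    have h0 := hwr _ hmid
    rw [hW, wronskian, hd1 _ hmid, hd2 _ hmid] at h0
    obtain ⟨n, hn, hnx⟩ := h.exists_normal hx hβ hL hSpos hw hw' hFT hmid (by
      rw [hw1 _ hmid, hw2 _ hmid]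
      linarith)
    refine coplanar_of_inner_eq_zero hn ?_
    rintro _ ⟨t, ht, rfl⟩
    exact hnx t ht
  tfae_have 3 → 1 := by
    intro h3
    rw [← hT0]
    exact coplanar_of_coplanar_image hL hx.start h3 hs'
  tfae_finish
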